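/- All spaces are metrizable, and ANRs are those for metrizable spaces: a metrizable space $Y$ is an ANR if, whenever it is embedded as a closed subset of a metrizable space $M$, its image is a retract of a neighbourhood of it in $M$. A polyhedron is a space homeomorphic to a simplicial complex with the metric topology. A closed subset $A$ of an ANR $M$ is a (closed) Z-set in $M$ if there is a homotopy $h_t\colon M\to M$, $t\in[0,1]$, such that $h_0=\mathrm{id}$ and $h_t(M)\subset M\setminus A$ for each $t>0$. A subset $A$ of an ANR $M$ is a fine Z-set in $M$ if it is a closed Z-set in $M$ and each compact $K\subset M$ lies in a compact ANR $N\subset M$ such that $N\cap A=K\cap A$ and $N\cap A$ is a Z-set in $N$. Let $\cdots\xrightarrow{p_1}P_1\xrightarrow{p_0}P_0$ be an inverse sequence of locally compact polyhedra and continuous maps, and let $X$ be its limit. The mapping cylinder of a continuous map $f\colon A\to B$ is the set $A\times(0,1]\sqcup B$ with its metrizable topology: $A\times(0,1]$ is open and has the product topology, and the basic neighbourhoods of $b\in B$ are the sets $V\cup\{(a,s)\in A\times(0,1]\mid f(a)\in V,\ s<\varepsilon\}$, where $V$ is an open neighbourhood of $b$ in $B$ and $\varepsilon>0$. The finite mapping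 telescope $P_{[0,n]}$ is defined by $P_{[0,0]}=P_0$ and by letting $P_{[0,n+1]}$ be the union of $P_{[0,n]}$ and the mapping cylinder of $p_n\colon P_{n+1}\to P_n$ along $P_n\subset P_{[0,n]}$, that is, the mapping cylinder of the composition $P_{n+1}\to P_n\subset P_{[0,n]}$; the copy of $P_{n+1}$ in $P_{[0,n+1]}$ is the top $P_{n+1}\times\{1\}$ of this cylinder. The extended mapping telescope $P_{[0,\infty]}$ is the inverse limit of the retractions $P_{[0,n+1]}\to P_{[0,n]}$ that collapse the last mapping cylinder onto its base. The inclusions $P_n\subset P_{[0,n]}$ induce a map $X\to P_{[0,\infty]}$. Then $P_{[0,\infty]}$ is an ANR, the map $X\to P_{[0,\infty]}$ is a closed embedding, and its image, which is identified with $X$, is a fine Z-set in $P_{[0,\infty]}$. -/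

import Mathlib

open Set Topology

universe u v

namespace FineShape

/-! ### Retracts and Z-sets -/

/-- `Y` is an absolute neighbourhood retract for metrizable spaces: `Y` is metrizable and whenever
`Y` is embedded as a closed subset of a metrizable space `M`, the image is a retract of some open
neighbourhood of it in `M`. -/
def IsANR (Y : Type u) [TopologicalSpace Y] : Prop :=
  TopologicalSpace.MetrizableSpace Y ∧
    ∀ (M : Type u) [TopologicalSpace M] [TopologicalSpace.MetrizableSpace M] (i : Y → M),
      IsClosedEmbedding i →
        ∃ U : Set M, IsOpen U ∧ ∃ hU : ∀ y, i y ∈ U,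
          ∃ r : C(U, Y), ∀ y, r ⟨i y, hU y⟩ = y

/-- `A` is a closed Z-set in `M`: `A` is closed and there is a homotopy `h_t : M → M` with
`h_0 = id` and `h_t(M) ⊆ M \ A` for each `t > 0`. -/
def IsZSet {M : Type u} [TopologicalSpace M] (A : Set M) : Prop :=
  IsClosed A ∧ ∃ h : C(unitInterval × M, M),
    (∀ x, h (0, x) = x) ∧ ∀ t : unitInterval, 0 < t → ∀ x, h (t, x) ∉ A

/-- `A` is a fine Z-set in the ANR `M`: it is a closed Z-set, and each compact `K ⊆ M` lies in
a compact ANR `N ⊆ M` such that `N ∩ A = K ∩ A` and `N ∩ A` is a Z-set in `N`. -/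
def IsFineZSet {M : Type u} [TopologicalSpace M] (A : Set M) : Prop :=
  IsANR M ∧ IsZSet A ∧
    ∀ K : Set M, IsCompact K → ∃ N : Set M,
      K ⊆ N ∧ IsCompact N ∧ IsANR N ∧ N ∩ A = K ∩ A ∧
        IsZSet ((Subtype.val : N → M) ⁻¹' A)

/-! ### Polyhedra -/

/-- The geometric realization of an abstract simplicial complex `K`: the set of all systems of
barycentric coordinates with support in a simplex of `K`, regarded as a subset of `ℓ¹(V)`. -/
def realization {V : Type u} (K : PreAbstractSimplicialComplex V) :
    Set (lp (fun _ : V => ℝ) 1) :=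
  {x | (∀ v, 0 ≤ x v) ∧ ∃ s ∈ K.faces, (∀ v, v ∉ s → x v = 0) ∧ ∑ v ∈ s, x v = 1}

/-- A polyhedron: a space homeomorphic to the realization of a simplicial complex, with
the metric topology. -/
def IsPolyhedron (P : Type u) [TopologicalSpace P] : Prop :=
  ∃ (V : Type u) (K : PreAbstractSimplicialComplex V), Nonempty (P ≃ₜ realization K)

/-! ### Mapping cylinders -/

section Cylinder

variable {A B : Type u} [TopologicalSpace A] [TopologicalSpace B]

/-- The mapping cylinder of `f : A → B`, as a set: the disjoint union of `A × (0, 1]` and `B`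
(so `(a, 0)` is identified with `f a`). -/
inductive MapCyl (f : C(A, B)) : Type u
  | body (a : A) (s : Ioc (0 : ℝ) 1) : MapCyl f
  | base (b : B) : MapCyl f

namespace MapCyl

variable (f : C(A, B))

/-- The retraction of the mapping cylinder onto its base, `(a, s) ↦ f a`. -/
def proj : MapCyl f → B
  | body a _ => f a
  | base b => b

/-- The height function of the mapping cylinder, `(a, s) ↦ s`, vanishing on the base. -/
def height : MapCyl f → ℝ
  | body _ s => s
  | base _ => 0

/-- The metrizable topology of the mapping cylinder: `A × (0, 1]` is open and has the product
topology, and a base point `b` has basic neighbourhoods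
`{z | proj z ∈ V and height z < ε}`, where `V` is a neighbourhood of `b` and `ε > 0`. -/
instance : TopologicalSpace (MapCyl f) where
  IsOpen W :=
    IsOpen {q : A × Ioc (0 : ℝ) 1 | body q.1 q.2 ∈ W} ∧
      ∀ b : B, base b ∈ W → ∃ V : Set B, IsOpen V ∧ b ∈ V ∧ ∃ ε : ℝ, 0 < ε ∧
        ∀ z : MapCyl f, proj f z ∈ V → height f z < ε → z ∈ W
  isOpen_univ := ⟨by simp, fun b _ => ⟨univ, isOpen_univ, mem_univ b, 1, one_pos, by simp⟩⟩
  isOpen_inter := by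
    rintro W W' ⟨h1, h2⟩ ⟨h1', h2'⟩
    refine ⟨h1.inter h1', fun b hb => ?_⟩
    obtain ⟨V, hV, hbV, ε, hε, h⟩ := h2 b hb.1
    obtain ⟨V', hV', hbV', ε', hε', h'⟩ := h2' b hb.2
    exact ⟨V ∩ V', hV.inter hV', ⟨hbV, hbV'⟩, min ε ε', lt_min hε hε', fun z hz hz' =>
      ⟨h z hz.1 (hz'.trans_le (min_le_left _ _)), h' z hz.2 (hz'.trans_le (min_le_right _ _))⟩⟩
  isOpen_sUnion := by
    intro S hS
    constructor
    · have : {q : A × Ioc (0 : ℝ) 1 | body q.1 q.2 ∈ ⋃₀ S} =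
          ⋃ W ∈ S, {q : A × Ioc (0 : ℝ) 1 | (body q.1 q.2 : MapCyl f) ∈ W} := by
        ext q; simp
      rw [this]
      exact isOpen_biUnion fun W hW => (hS W hW).1
    · rintro b ⟨W, hW, hb⟩
      obtain ⟨V, hV, hbV, ε, hε, h⟩ := (hS W hW).2 b hb
      exact ⟨V, hV, hbV, ε, hε, fun z hz hz' => ⟨W, hW, h z hz hz'⟩⟩

/-- The retraction of the mapping cylinder onto its base, as a continuous map. -/
def retr : C(MapCyl f, B) where
  toFun := proj f
  continuous_toFun := by
    refine ⟨fun V hV => ⟨?_, fun b hb => ⟨V, hV, hb, 1, one_pos, fun z hz _ => hz⟩⟩⟩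
    exact hV.preimage (f.continuous.comp continuous_fst)

/-- The inclusion of the top `A × {1}` of the mapping cylinder. -/
def top : C(A, MapCyl f) where
  toFun a := body a ⟨1, one_pos, le_rfl⟩
  continuous_toFun := ⟨fun _ hW =>
    hW.1.preimage (continuous_id.prodMk continuous_const)⟩

end MapCyl

end Cylinder

/-! ### Mapping telescopes of an inverse sequence `⋯ → P 2 → P 1 → P 0` -/

section Telescope

variable {P : ℕ → Type u} [∀ i, TopologicalSpace (P i)] (p : ∀ i, C(P (i + 1), P i))

/-- The limit of the inverse sequence. -/
def InverseLimit : Type u :=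
  {x : ∀ i, P i // ∀ i, p i (x (i + 1)) = x i}

instance : TopologicalSpace (InverseLimit p) :=
  inferInstanceAs (TopologicalSpace {x : ∀ i, P i // ∀ i, p i (x (i + 1)) = x i})

/-- The finite mapping telescope `P_[0,n]`, together with the inclusion of `P n` as its last
level. `P_[0,0]` is `P 0`, and `P_[0,n+1]` is obtained by attaching the mapping cylinder of
`p n : P (n + 1) → P n` to `P_[0,n]` along `P n`; that is, it is the mapping cylinder of
the composition `P (n + 1) → P n → P_[0,n]`. -/
def telescopeAux : (n : ℕ) → (T : TopCat.{u}) × C(P n, T)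
  | 0 => ⟨TopCat.of (P 0), ContinuousMap.id (P 0)⟩
  | n + 1 => ⟨TopCat.of (MapCyl ((telescopeAux n).2.comp (p n))),
      MapCyl.top ((telescopeAux n).2.comp (p n))⟩

/-- The finite mapping telescope `P_[0,n]`. -/
abbrev FiniteTelescope (n : ℕ) : Type u := (telescopeAux p n).1

/-- The inclusion of `P n` as the last level of `P_[0,n]`. -/
def lastLevel (n : ℕ) : C(P n, FiniteTelescope p n) := (telescopeAux p n).2

/-- The retraction `P_[0,n+1] → P_[0,n]`, collapsing the last mapping cylinder to its base. -/
def telescopeRetr (n : ℕ) : C(FiniteTelescope p (n + 1), FiniteTelescope p n) :=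
  MapCyl.retr ((lastLevel p n).comp (p n))

/-- The extended mapping telescope `P_[0,∞]`: the inverse limit of the retractions
`P_[0,n+1] → P_[0,n]`. -/
def ExtendedTelescope : Type u := InverseLimit (telescopeRetr p)

instance : TopologicalSpace (ExtendedTelescope p) :=
  inferInstanceAs (TopologicalSpace (InverseLimit (telescopeRetr p)))

theorem telescopeRetr_lastLevel (n : ℕ) (x : P (n + 1)) :
    telescopeRetr p n (lastLevel p (n + 1) x) = lastLevel p n (p n x) := rfl

/-- The inclusion of the limit of the inverse sequence in `P_[0,∞]` (as the level `∞`). -/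
def limitInclusion (x : InverseLimit p) : ExtendedTelescope p :=
  ⟨fun n => lastLevel p n (x.1 n), fun n => by rw [telescopeRetr_lastLevel, x.2 n]⟩

end Telescope

end FineShape

/-! The argument runs through absolute neighbourhood extensors (`IsANESet`), which are ANRs when
they are metrizable. Cutting down the mapping cylinders one after another, starting from infinity,
gives a homotopy `cutExtended` of the extended telescope. It begins at the identity, and at every
positive time its image lies in a finite telescope. Points of the limit have height 1 in every
cylinder, so the image then misses the limit. Hence the limit is a Z-set.

A metrizable set that such a homotopy deforms into an increasing sequence of extensors is itself an
extensor (`IsANESet.of_homotopy`). This reduces the ANR property to finite telescopes. These are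
iterated mapping cylinders, handled by `MapCyl.isANESet_setOf_le`, and the induction rests on metric
polyhedra (`isANESet_realization`).

For the fine property, a compact `K` is enclosed in a set `N = subExtended p Q φ`: over a finite
subcomplex `Q` of `P 0`, and in the `n`-th cylinder under the graph of `φ n`. Compactness of the
sets `{δ ≤ φ n}`, `δ > 0`, makes `N` compact. Admissibility says that new cylinders stand only over
places where the previous one has full height, so the two extensor results apply to `N` as well. The
cutting homotopy preserves `N`, so it also shows that the limit meets `N` in a Z-set. Finally, `φ n`
is positive only at points whose images are `1 / (n + 1)`-close to `K`, and letting `n → ∞` puts the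
limit points of `N` in `K` (`exists_isAdmissible_of_isCompact`). -/

open Filter

namespace FineShape

/-! ### Extension of maps and absolute neighbourhood extensors -/

/-- **Dugundji extension theorem**, with values in a prescribed convex set. -/
theorem exists_continuous_extension_convex {Z : Type*} [TopologicalSpace Z]
    [TopologicalSpace.MetrizableSpace Z] {L : Type*} [NormedAddCommGroup L] [NormedSpace ℝ L]
    {A : Set Z} (hA : IsClosed A) {f : Z → L} (hf : ContinuousOn f A) {C : Set L}
    (hC : Convex ℝ C) (hne : C.Nonempty) (hfC : MapsTo f A C) :
    ∃ F : Z → L, Continuous F ∧ (∀ z, F z ∈ C) ∧ EqOn F f A := by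
  let _ := TopologicalSpace.metrizableSpaceMetric Z
  rcases A.eq_empty_or_nonempty with rfl | hAne
  · obtain ⟨c, hc⟩ := hne
    exact ⟨fun _ => c, continuous_const, fun _ => hc, eqOn_empty _ _⟩
  -- Off `A`, values are averages of values of `f` at nearby points of `A`. A point of `A` within
  -- twice the distance of `z` stays within four times the distance of each `y` near `z`, so its
  -- value is a locally constant selection of `t`.
  let t : (Aᶜ : Set Z) → Set L := fun z =>
    convexHull ℝ (f '' (A ∩ Metric.ball z (4 * Metric.infDist z.1 A)))
  obtain ⟨g, hg⟩ : ∃ g : C((Aᶜ : Set Z), L), ∀ z, g z ∈ t z := by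
    refine exists_continuous_forall_mem_convex_of_local_const (fun z => convex_convexHull ℝ _) ?_
    intro z
    have hpos : 0 < Metric.infDist z.1 A := (hA.notMem_iff_infDist_pos hAne).1 z.2
    obtain ⟨a, haA, ha⟩ := (Metric.infDist_lt_iff hAne).1
      (show Metric.infDist z.1 A < 2 * Metric.infDist z.1 A by linarith)
    refine ⟨f a, ?_⟩
    have hev : ∀ᶠ y : (Aᶜ : Set Z) in 𝓝 z, dist y.1 a < 4 * Metric.infDist y.1 A := by
      apply ContinuousAt.eventually_lt
      · fun_prop
      · exact (continuous_const.mul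
          ((Metric.continuous_infDist_pt A).comp continuous_subtype_val)).continuousAt
      · linarith
    filter_upwards [hev] with y hy
    exact subset_convexHull ℝ _ ⟨a, ⟨haA, by rwa [Metric.mem_ball, dist_comm]⟩, rfl⟩
  classical
  let F : Z → L := fun z => if h : z ∈ A then f z else g ⟨z, h⟩
  have hFA : EqOn F f A := fun z hz => by simp [F, hz]
  have hFg : ∀ z (h : z ∉ A), F z = g ⟨z, h⟩ := fun z h => by simp [F, h]
  refine ⟨F, ?_, ?_, hFA⟩
  · rw [continuous_iff_continuousAt]
    intro z
    by_cases hz : z ∈ A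
    · rw [Metric.continuousAt_iff]
      intro ε hε
      obtain ⟨δ, hδ, h⟩ := Metric.continuousOn_iff.1 hf z hz ε hε
      -- A point of `A` used at `y` is within `4 * dist y z` of `y`, hence within `5 * dist y z < δ`
      -- of `z`.
      refine ⟨δ / 5, by positivity, fun {y} hy => ?_⟩
      rw [hFA hz]
      by_cases hyA : y ∈ A
      · rw [hFA hyA]; exact h y hyA (by linarith)
      · rw [hFg y hyA]
        have hsub : t ⟨y, hyA⟩ ⊆ Metric.ball (f z) ε := by
          refine convexHull_min ?_ (convex_ball _ _)
          rintro _ ⟨a, ⟨haA, ha⟩, rfl⟩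
          refine h a haA ?_
          have h1 : Metric.infDist y A ≤ dist y z := Metric.infDist_le_dist_of_mem hz
          have h2 : dist a y < 4 * Metric.infDist y A := ha
          linarith [dist_triangle a y z]
        exact hsub (hg _)
    · have : ContinuousOn F Aᶜ := by
        rw [continuousOn_iff_continuous_domRestrict]
        convert g.continuous using 1
        ext y
        exact hFg y.1 y.2
      exact this.continuousAt (hA.isOpen_compl.mem_nhds hz)
  · intro z
    by_cases hz : z ∈ A
    · rw [hFA hz]; exact hfC hz
    · rw [hFg z hz]
      refine convexHull_min ?_ hC (hg _)
      rintro _ ⟨a, ⟨haA, -⟩, rfl⟩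
      exact hfC haA

/-- A subset `S` of a space is an absolute neighbourhood extensor for metrizable spaces (in the
subspace topology): maps into `S` from closed subsets of metrizable spaces extend to open
neighbourhoods. -/
def IsANESet {Y : Type u} [TopologicalSpace Y] (S : Set Y) : Prop :=
  ∀ (Z : Type u) [TopologicalSpace Z] [TopologicalSpace.MetrizableSpace Z] (A : Set Z) (f : Z → Y),
    IsClosed A → ContinuousOn f A → MapsTo f A S →
      ∃ U, IsOpen U ∧ A ⊆ U ∧ ∃ F : Z → Y, ContinuousOn F U ∧ MapsTo F U S ∧ EqOn F f A

section ANE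

variable {Y Y' Z : Type u} [TopologicalSpace Y] [TopologicalSpace Y'] [TopologicalSpace Z]

theorem IsANESet.of_retract {S : Set Y} {S' : Set Y'} (hS : IsANESet S) (i : Y' → Y) (r : Y → Y')
    (hi : ContinuousOn i S') (hr : ContinuousOn r S) (hiS : MapsTo i S' S) (hrS : MapsTo r S S')
    (hri : ∀ y ∈ S', r (i y) = y) : IsANESet S' := by
  intro Z _ _ A f hA hf hfS
  obtain ⟨U, hU, hAU, F, hF, hFS, hFf⟩ := hS Z A (i ∘ f) hA (hi.comp hf hfS) (hiS.comp hfS)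
  refine ⟨U, hU, hAU, r ∘ F, hr.comp hF hFS, hrS.comp hFS, fun a ha => ?_⟩
  simp only [Function.comp, hFf ha]
  exact hri _ (hfS ha)

theorem IsANESet.inter_isOpen {S O : Set Y} (hS : IsANESet S) (hO : IsOpen O) :
    IsANESet (S ∩ O) := by
  intro Z _ _ A f hA hf hfS
  obtain ⟨U, hU, hAU, F, hF, hFS, hFf⟩ := hS Z A f hA hf fun a ha => (hfS ha).1
  refine ⟨U ∩ F ⁻¹' O, hF.isOpen_inter_preimage hU hO, fun a ha => ⟨hAU ha, ?_⟩, F,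
    hF.mono inter_subset_left, fun z hz => ⟨hFS hz.1, hz.2⟩, hFf⟩
  simpa only [mem_preimage, hFf ha] using (hfS ha).2

theorem IsANESet.preimage_of_isEmbedding {S : Set Y'} (hS : IsANESet S) {i : Y → Y'} (hi : IsEmbedding i)
    (hSi : S ⊆ range i) : IsANESet (i ⁻¹' S) := by
  rcases isEmpty_or_nonempty Y with hemp | hne
  · intro Z _ _ A f _ _ _
    have : IsEmpty Z := ⟨fun z => isEmptyElim (f z)⟩
    exact ⟨univ, isOpen_univ, subset_univ _, f, continuous_of_const (fun z => isEmptyElim z)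
      |>.continuousOn, fun z => isEmptyElim z, fun z => isEmptyElim z⟩
  · refine hS.of_retract i (Function.invFun i) hi.continuous.continuousOn ?_ (fun y hy => hy) ?_
      fun y _ => Function.leftInverse_invFun hi.injective y
    · rw [hi.isInducing.continuousOn_iff]
      exact continuousOn_id.congr fun y hy => Function.invFun_eq (hSi hy)
    · intro y hy
      rw [mem_preimage, Function.invFun_eq (hSi hy)]
      exact hy

/-- The retraction is an extension of the inverse of the closed embedding. -/
theorem IsANESet.isANR [TopologicalSpace.MetrizableSpace Y] (hY : IsANESet (univ : Set Y)) :
    IsANR Y := by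
  refine ⟨inferInstance, fun M _ _ i hi => ?_⟩
  rcases isEmpty_or_nonempty Y with hemp | hne
  · exact ⟨∅, isOpen_empty, fun y => (IsEmpty.false y).elim,
      ⟨fun z => (z.2).elim, continuous_iff_continuousAt.2 fun z => (z.2).elim⟩,
      fun y => (IsEmpty.false y).elim⟩
  · have hinv : ∀ y, Function.invFun i (i y) = y := Function.leftInverse_invFun hi.injective
    obtain ⟨U, hU, hAU, F, hF, -, hFf⟩ := hY M (range i) (Function.invFun i)
      hi.isClosed_range (by
        rw [← image_univ, hi.isEmbedding.isInducing.continuousOn_image_iff]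
        exact (continuous_id.congr fun y => (hinv y).symm).continuousOn)
      (mapsTo_univ _ _)
    exact ⟨U, hU, fun y => hAU ⟨y, rfl⟩, ⟨fun z => F z, hF.domRestrict⟩,
      fun y => (hFf ⟨y, rfl⟩).trans (hinv y)⟩

theorem IsANESet.isANR_coe [TopologicalSpace.MetrizableSpace Y] {S : Set Y} (hS : IsANESet S) :
    IsANR S := by
  refine IsANESet.isANR ?_
  convert hS.preimage_of_isEmbedding (IsEmbedding.subtypeVal (p := (· ∈ S)))
    Subtype.range_val.ge
  simp

variable [TopologicalSpace.MetrizableSpace Z]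

/-- The open set `V` is itself a metrizable space in which `V ∩ C` is closed, so the definition
applies with `V` in place of `Z`. -/
theorem IsANESet.exists_extension_of_isOpen {S : Set Y} (hS : IsANESet S) {V C : Set Z}
    (hV : IsOpen V) (hC : IsClosed C) {f : Z → Y} (hf : ContinuousOn f (V ∩ C))
    (hfS : MapsTo f (V ∩ C) S) :
    ∃ U, IsOpen U ∧ V ∩ C ⊆ U ∧ U ⊆ V ∧
      ∃ F : Z → Y, ContinuousOn F U ∧ MapsTo F U S ∧ EqOn F f (V ∩ C) := by
  obtain ⟨U, hU, hAU, F, hF, hFS, hFf⟩ := hS V (Subtype.val ⁻¹' C) (fun z => f z)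
    (hC.preimage continuous_subtype_val)
    (hf.comp continuous_subtype_val.continuousOn fun z hz => ⟨z.2, hz⟩)
    (fun z hz => hfS ⟨z.2, hz⟩)
  classical
  refine ⟨Subtype.val '' U, hV.isOpenMap_subtype_val U hU, fun z hz => ⟨⟨z, hz.1⟩, hAU hz.2, rfl⟩,
    by rintro _ ⟨z, -, rfl⟩; exact z.2, fun z => if h : z ∈ V then F ⟨z, h⟩ else f z, ?_, ?_, ?_⟩
  · rw [IsInducing.subtypeVal.continuousOn_image_iff]
    exact hF.congr fun z hz => by simp
  · rintro _ ⟨z, hz, rfl⟩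
    simpa using hFS hz
  · intro z hz
    simp only [hz.1, dite_true]
    exact hFf hz.2

/-- Homotopy extension: two maps into an absolute neighbourhood extensor on an open set `V` and
a homotopy between them on the closed subset `V ∩ C` of `V`, extend to a homotopy on
a neighbourhood of `V ∩ C`. -/
theorem IsANESet.exists_homotopy {S : Set Y} (hS : IsANESet S) {V C : Set Z}
    (hV : IsOpen V) (hC : IsClosed C) {α β : ℝ} (hαβ : α < β) {g₀ g₁ : Z → Y}
    {H : Z × ℝ → Y} (hg₀ : ContinuousOn g₀ V) (hg₁ : ContinuousOn g₁ V) (hg₀S : MapsTo g₀ V S)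
    (hg₁S : MapsTo g₁ V S) (hH : ContinuousOn H ((V ∩ C) ×ˢ Icc α β))
    (hHS : MapsTo H ((V ∩ C) ×ˢ Icc α β) S) (h₀ : ∀ z ∈ V ∩ C, H (z, α) = g₀ z)
    (h₁ : ∀ z ∈ V ∩ C, H (z, β) = g₁ z) :
    ∃ U, IsOpen U ∧ V ∩ C ⊆ U ∧ U ⊆ V ∧ ∃ G : Z × ℝ → Y, ContinuousOn G (U ×ˢ Icc α β) ∧
      MapsTo G (U ×ˢ Icc α β) S ∧ (∀ z ∈ U, G (z, α) = g₀ z) ∧ (∀ z ∈ U, G (z, β) = g₁ z) ∧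
      EqOn G H ((V ∩ C) ×ˢ Icc α β) := by
  classical
  -- The partial homotopy lives on the two ends `V × {α}`, `V × {β}` and on `(V ∩ C) × [α, β]`, a
  -- closed subset of `V × ℝ`. After it is extended to a neighbourhood, the tube lemma yields a
  -- neighbourhood of `V ∩ C` over which the whole interval is covered.
  let k : Z × ℝ → Y := fun q => if q.2 = α then g₀ q.1 else if q.2 = β then g₁ q.1 else H q
  let D₀ : Set (Z × ℝ) := Prod.snd ⁻¹' {α}
  let D₁ : Set (Z × ℝ) := Prod.snd ⁻¹' {β}
  let D₂ : Set (Z × ℝ) := C ×ˢ Icc α β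
  have hD₀ : IsClosed D₀ := isClosed_singleton.preimage continuous_snd
  have hD₁ : IsClosed D₁ := isClosed_singleton.preimage continuous_snd
  have hD₂ : IsClosed D₂ := hC.prod isClosed_Icc
  have hk₀ : ∀ z, k (z, α) = g₀ z := fun z => by simp [k]
  have hk₁ : ∀ z, k (z, β) = g₁ z := fun z => by simp [k, hαβ.ne']
  have hkH : EqOn k H ((V ∩ C) ×ˢ Icc α β) := by
    rintro ⟨z, s⟩ ⟨hz, -⟩
    by_cases hs : s = α
    · subst hs; rw [hk₀, h₀ z hz]
    by_cases hs' : s = β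
    · subst hs'; rw [hk₁, h₁ z hz]
    · simp [k, hs, hs']
  have hVR : IsOpen (V ×ˢ (univ : Set ℝ)) := hV.prod isOpen_univ
  have hcont : ContinuousOn k ((V ×ˢ (univ : Set ℝ)) ∩ (D₀ ∪ D₁ ∪ D₂)) := by
    have key : ∀ D : Set (Z × ℝ), IsClosed D → ContinuousOn k ((V ×ˢ (univ : Set ℝ)) ∩ D) →
        ∀ q ∈ V ×ˢ (univ : Set ℝ), ContinuousWithinAt k ((V ×ˢ (univ : Set ℝ)) ∩ D) q := by
      intro D hD hc q hq
      by_cases hqD : q ∈ D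
      · exact hc q ⟨hq, hqD⟩
      · exact continuousWithinAt_of_notMem_closure fun h =>
          hqD (hD.closure_subset_iff.2 inter_subset_right h)
    intro q hq
    rw [inter_union_distrib_left, inter_union_distrib_left]
    refine ((key D₀ hD₀ ?_ q hq.1).union (key D₁ hD₁ ?_ q hq.1)).union (key D₂ hD₂ ?_ q hq.1)
    · refine (hg₀.comp continuous_fst.continuousOn fun q hq => hq.1.1).congr ?_
      rintro ⟨z, s⟩ ⟨-, hs⟩
      obtain rfl : s = α := hs
      exact hk₀ z
    · refine (hg₁.comp continuous_fst.continuousOn fun q hq => hq.1.1).congr ?_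
      rintro ⟨z, s⟩ ⟨-, hs⟩
      obtain rfl : s = β := hs
      exact hk₁ z
    · exact (hH.congr hkH).mono fun q hq => ⟨⟨hq.1.1, hq.2.1⟩, hq.2.2⟩
  have hkS : MapsTo k ((V ×ˢ (univ : Set ℝ)) ∩ (D₀ ∪ D₁ ∪ D₂)) S := by
    rintro ⟨z, s⟩ ⟨hz, (hs | hs) | hs⟩
    · obtain rfl : s = α := hs
      rw [hk₀]; exact hg₀S hz.1
    · obtain rfl : s = β := hs
      rw [hk₁]; exact hg₁S hz.1
    · have : (z, s) ∈ (V ∩ C) ×ˢ Icc α β := ⟨⟨hz.1, hs.1⟩, hs.2⟩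
      rw [hkH this]; exact hHS this
  obtain ⟨U, hU, hsub, -, G, hG, hGS, hGk⟩ :=
    hS.exists_extension_of_isOpen hVR ((hD₀.union hD₁).union hD₂) hcont hkS
  refine ⟨V ∩ {z | ∀ s ∈ Icc α β, (z, s) ∈ U}, ?_, ?_, inter_subset_left, G,
    hG.mono fun q hq => hq.1.2 _ hq.2, hGS.mono_left fun q hq => hq.1.2 _ hq.2, ?_, ?_, ?_⟩
  · refine hV.inter (isOpen_iff_mem_nhds.2 fun z hz => ?_)
    exact isCompact_Icc.eventually_forall_of_forall_eventually
      (P := fun z s => (z, s) ∈ U) fun s hs => hU.mem_nhds (hz s hs)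
  · exact fun z hz => ⟨hz.1, fun s hs => hsub ⟨⟨hz.1, trivial⟩, Or.inr ⟨hz.2, hs⟩⟩⟩
  · intro z hz
    rw [hGk ⟨⟨hz.1, trivial⟩, Or.inl (Or.inl rfl)⟩, hk₀]
  · intro z hz
    rw [hGk ⟨⟨hz.1, trivial⟩, Or.inl (Or.inr rfl)⟩, hk₁]
  · intro q hq
    rw [hGk ⟨⟨hq.1.1, trivial⟩, Or.inr ⟨hq.1.2, hq.2⟩⟩, hkH hq]

end ANE

/-! ### Dyadic control functions and the homotopy criterion for extensors -/

/-- A continuous function with prescribed dyadic bounds, from a sequence of pairs of disjoint closed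
sets. -/
theorem exists_continuous_dyadic {Z : Type*} [TopologicalSpace Z] [NormalSpace Z]
    {C D : ℕ → Set Z} (hC : ∀ n, IsClosed (C n)) (hD : ∀ n, IsClosed (D n))
    (hCD : ∀ n, Disjoint (C n) (D n)) :
    ∃ μ : Z → ℝ, Continuous μ ∧ (∀ z, 0 ≤ μ z) ∧
      (∀ n z, (∀ m < n, z ∈ C m) → μ z ≤ 2 * (1 / 2) ^ n) ∧
      ∀ n z, (∀ m, n ≤ m → z ∈ D m) → 2 * (1 / 2) ^ n ≤ μ z := by
  choose φ hφC hφD hφ using fun n => exists_continuous_zero_one_of_isClosed (hC n) (hD n) (hCD n)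
  have hle : ∀ n z, (1 / 2 : ℝ) ^ n * φ n z ≤ (1 / 2) ^ n := fun n z =>
    mul_le_of_le_one_right (by positivity) (hφ n z).2
  have hnn : ∀ n z, 0 ≤ (1 / 2 : ℝ) ^ n * φ n z := fun n z =>
    mul_nonneg (by positivity) (hφ n z).1
  have hsum : ∀ z, Summable fun n => (1 / 2 : ℝ) ^ n * φ n z := fun z =>
    Summable.of_nonneg_of_le (fun n => hnn n z) (fun n => hle n z) summable_geometric_two
  have hgeo : ∀ n, ∑' m, (1 / 2 : ℝ) ^ (m + n) = 2 * (1 / 2) ^ n := fun n => by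
    simp_rw [pow_add]
    rw [tsum_mul_right, tsum_geometric_two]
  have hsg : ∀ n, Summable fun m => (1 / 2 : ℝ) ^ (m + n) := fun n =>
    (summable_nat_add_iff n).2 summable_geometric_two
  -- Membership in the first `C m` kills the initial terms, and membership in all later `D m` makes
  -- the tail full; the full tail from `n` on is `2 * (1 / 2) ^ n`.
  refine ⟨fun z => ∑' n, (1 / 2 : ℝ) ^ n * φ n z, ?_, fun z => tsum_nonneg fun n => hnn n z,
    fun n z hz => ?_, fun n z hz => ?_⟩
  · refine continuous_tsum (fun n => by fun_prop) summable_geometric_two fun n z => ?_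
    rw [Real.norm_of_nonneg (hnn n z)]
    exact hle n z
  · beta_reduce
    rw [← (hsum z).sum_add_tsum_nat_add n, Finset.sum_eq_zero, zero_add, ← hgeo]
    · exact Summable.tsum_le_tsum (fun m => hle _ z) ((summable_nat_add_iff n).2 (hsum z)) (hsg n)
    · intro m hm
      simp [hφC m (hz m (Finset.mem_range.1 hm))]
  · beta_reduce
    rw [← (hsum z).sum_add_tsum_nat_add n, ← hgeo]
    refine le_add_of_nonneg_of_le (Finset.sum_nonneg fun m _ => hnn m z) ?_
    refine Summable.tsum_le_tsum (fun m => ?_) (hsg n) ((summable_nat_add_iff n).2 (hsum z))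
    simp [hφD (m + n) (hz (m + n) (Nat.le_add_left n m))]

/-- A function that vanishes exactly on a closed set and is so small that it forces its
arguments into prescribed neighbourhoods of this set. -/
theorem exists_continuous_lt_dyadic_imp_mem {Z : Type*} [MetricSpace Z] {A : Set Z}
    (hA : IsClosed A) {V : ℕ → Set Z} (hV : ∀ n, IsOpen (V n)) (hAV : ∀ n, A ⊆ V n) :
    ∃ μ : Z → ℝ, Continuous μ ∧ (∀ z, 0 ≤ μ z) ∧ (∀ z, μ z = 0 ↔ z ∈ A) ∧
      ∀ n z, μ z < 2 * (1 / 2) ^ n → z ∈ V n := by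
  -- The sets are made decreasing, and the distance bound makes their intersection equal to `A`. The
  -- extended distance keeps this true for empty `A`, where `Metric.infDist` would be `0`.
  let V' : ℕ → Set Z := fun n => {z | ∀ m ≤ n, z ∈ V m} ∩ {z | Metric.infEDist z A < (2⁻¹) ^ n}
  have hV' : ∀ n, IsOpen (V' n) := fun n => by
    refine IsOpen.inter ?_ (isOpen_lt (Metric.continuous_infEDist) continuous_const)
    have : {z | ∀ m ≤ n, z ∈ V m} = ⋂ m ∈ Iic n, V m := by ext; simp
    rw [this]
    exact (finite_Iic n).isOpen_biInter fun m _ => hV m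
  have hAV' : ∀ n, A ⊆ V' n := fun n z hz => ⟨fun m _ => hAV m hz, by
    simpa [Metric.infEDist_zero_of_mem hz] using ENNReal.pow_pos (by norm_num) n⟩
  have hanti : ∀ n m, n ≤ m → V' m ⊆ V' n := fun n m hnm z hz =>
    ⟨fun k hk => hz.1 k (hk.trans hnm),
      lt_of_lt_of_le hz.2 (pow_le_pow_right_of_le_one' (show (2⁻¹ : ENNReal) ≤ 1 by norm_num) hnm)⟩
  obtain ⟨μ, hμ, hμ0, hμC, hμD⟩ := exists_continuous_dyadic (C := fun _ => A)
    (D := fun n => (V' n)ᶜ) (fun _ => hA) (fun n => (hV' n).isClosed_compl)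
    (fun n => disjoint_compl_right_iff_subset.2 (hAV' n))
  have hmem : ∀ n z, μ z < 2 * (1 / 2) ^ n → z ∈ V' n := fun n z hz => by
    by_contra h
    exact absurd (hμD n z fun m hm hzm => h (hanti n m hm hzm)) (not_le.2 hz)
  refine ⟨μ, hμ, hμ0, fun z => ⟨fun hz => ?_, fun hz => ?_⟩, fun n z hz => (hmem n z hz).1 n le_rfl⟩
  · have h0 : Metric.infEDist z A = 0 := by
      refine le_antisymm (ge_of_tendsto' (x := atTop) (ENNReal.tendsto_pow_atTop_nhds_zero_of_lt_one
        (show (2⁻¹ : ENNReal) < 1 by norm_num)) fun n => (hmem n z ?_).2.le) bot_le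
      rw [hz]; positivity
    rwa [← hA.closure_eq, Metric.mem_closure_iff_infEDist_zero]
  · refine le_antisymm (ge_of_tendsto' (x := atTop) (f := fun n : ℕ => 2 * (1 / 2 : ℝ) ^ n) ?_ fun n =>
      hμC n z fun _ _ => hz) (hμ0 z)
    simpa using (tendsto_pow_atTop_nhds_zero_of_lt_one (show (0 : ℝ) ≤ 1 / 2 by norm_num)
      (by norm_num)).const_mul 2

/-- A set `N` in a metrizable space that is deformed, by arbitrarily short homotopies, into
an increasing sequence of absolute neighbourhood extensors is itself one. -/
theorem IsANESet.of_homotopy {E : Type u} [TopologicalSpace E] [TopologicalSpace.MetrizableSpace E]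
    {N : Set E} {S : ℕ → Set E} {H : ℝ × E → E} (hH : Continuous H) (hH0 : ∀ y, H (0, y) = y)
    (hS : ∀ n, IsANESet (S n)) (hmono : ∀ n, S n ⊆ S (n + 1)) (hSN : ∀ n, S n ⊆ N)
    (hHS : ∀ (n : ℕ) (s : ℝ), (1 / 2) ^ n ≤ s → ∀ y ∈ N, H (s, y) ∈ S n) : IsANESet N := by
  intro Z _ _ A f hA hf hfN
  let _ := TopologicalSpace.metrizableSpaceMetric Z
  let _ := TopologicalSpace.metrizableSpaceMetric E
  set r : ℕ → ℝ := fun n => (1 / 2) ^ n with hr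
  have hrpos : ∀ n, 0 < r n := fun n => by positivity
  have hrsucc : ∀ n, r (n + 1) = r n / 2 := fun n => by simp only [hr, pow_succ]; ring
  have hrlt : ∀ n, r (n + 1) < r n := fun n => by rw [hrsucc]; linarith [hrpos n]
  have hcH : ∀ g : Z → ℝ, Continuous g → ContinuousOn (fun z => H (g z, f z)) A := fun g hg =>
    hH.comp_continuousOn (hg.continuousOn.prodMk hf)
  have hcH2 : ContinuousOn (fun q : Z × ℝ => H (q.2, f q.1)) (A ×ˢ univ) :=
    hH.comp_continuousOn (continuous_snd.continuousOn.prodMk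
      (hf.comp continuous_fst.continuousOn fun q hq => hq.1))
  choose U hU hAU F hF hFS hFf using fun n => hS n Z A (fun z => H (r n, f z)) hA
    (hcH _ continuous_const) fun z hz => hHS n _ le_rfl _ (hfN hz)
  -- On `A`, the map `H (s, f a)` for `s` between `r (n + 1)` and `r n` is a homotopy in `S (n + 1)`
  -- between the restrictions of `F (n + 1)` and `F n`. It extends near `A`, and near enough to `A`
  -- the extension stays `r n`-close to the original.
  have step : ∀ n, ∃ V : Set Z, IsOpen V ∧ A ⊆ V ∧ ∃ G : Z × ℝ → E,
      ContinuousOn G (V ×ˢ Icc (r (n + 1)) (r n)) ∧ MapsTo G (V ×ˢ Icc (r (n + 1)) (r n)) N ∧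
      (∀ z ∈ V, G (z, r (n + 1)) = F (n + 1) z) ∧ (∀ z ∈ V, G (z, r n) = F n z) ∧
      ∀ z ∈ V, ∀ s ∈ Icc (r (n + 1)) (r n), ∃ a ∈ A, dist z a < r n ∧
        dist (G (z, s)) (H (s, f a)) < r n := by
    intro n
    have hUU : A ⊆ (U (n + 1) ∩ U n) ∩ A := fun z hz => ⟨⟨hAU _ hz, hAU _ hz⟩, hz⟩
    obtain ⟨V, hV, hAV, -, G, hG, hGS, hG0, hG1, hGH⟩ := (hS (n + 1)).exists_homotopy
      ((hU (n + 1)).inter (hU n)) hA (hrlt n) (g₀ := F (n + 1)) (g₁ := F n)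
      (H := fun q => H (q.2, f q.1)) ((hF (n + 1)).mono inter_subset_left)
      ((hF n).mono inter_subset_right) ((hFS (n + 1)).mono_left inter_subset_left)
      (((hFS n).mono_left inter_subset_right).mono_right (hmono n))
      (hcH2.mono fun q hq => ⟨hq.1.2, trivial⟩)
      (fun q hq => hHS _ _ hq.2.1 _ (hfN hq.1.2))
      (fun z hz => (hFf (n + 1) hz.2).symm) (fun z hz => (hFf n hz.2).symm)
    replace hAV := hUU.trans hAV
    refine ⟨interior {z | z ∈ V ∧ ∀ s ∈ Icc (r (n + 1)) (r n), ∃ a ∈ A, dist z a < r n ∧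
        dist (G (z, s)) (H (s, f a)) < r n}, isOpen_interior, fun a ha => ?_, G, ?_⟩
    · rw [mem_interior_iff_mem_nhds]
      refine inter_mem (hV.mem_nhds (hAV ha)) ?_
      have hev : ∀ s ∈ Icc (r (n + 1)) (r n), ∀ᶠ q : Z × ℝ in 𝓝 (a, s),
          q.2 ∈ Icc (r (n + 1)) (r n) → dist q.1 a < r n ∧ dist (G q) (H (q.2, f a)) < r n := by
        intro s hs
        have h1 : ContinuousWithinAt (fun q : Z × ℝ => dist (G q) (H (q.2, f a)))
            (V ×ˢ Icc (r (n + 1)) (r n)) (a, s) :=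
          (hG (a, s) ⟨hAV ha, hs⟩).dist
            (hH.comp (continuous_snd.prodMk continuous_const)).continuousWithinAt
        have h2 : dist (G (a, s)) (H (s, f a)) < r n := by
          rw [hGH ⟨hUU ha, hs⟩, dist_self]; exact hrpos n
        filter_upwards [eventually_nhdsWithin_iff.1 (h1.eventually_lt_const h2),
          continuous_fst.continuousAt.eventually_mem (hV.mem_nhds (hAV ha)),
          continuous_fst.continuousAt.eventually_mem (Metric.ball_mem_nhds a (hrpos n))]
          with q hq1 hq2 hq3 hq
        exact ⟨hq3, hq1 ⟨hq2, hq⟩⟩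
      filter_upwards [isCompact_Icc.eventually_forall_of_forall_eventually (P := fun z s =>
        s ∈ Icc (r (n + 1)) (r n) → dist z a < r n ∧ dist (G (z, s)) (H (s, f a)) < r n) hev]
        with z hz s hs
      exact ⟨a, ha, hz s hs hs⟩
    · have hsub := fun z (hz : z ∈ interior {z | z ∈ V ∧ ∀ s ∈ Icc (r (n + 1)) (r n), ∃ a ∈ A,
        dist z a < r n ∧ dist (G (z, s)) (H (s, f a)) < r n}) => interior_subset hz
      exact ⟨hG.mono (prod_mono_left fun z hz => (hsub z hz).1),
        (hGS.mono_left (prod_mono_left fun z hz => (hsub z hz).1)).mono_right (hSN _),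
        fun z hz => hG0 z (hsub z hz).1, fun z hz => hG1 z (hsub z hz).1,
        fun z hz => (hsub z hz).2⟩
  choose V hV hAV G hG hGN hG0 hG1 hGH using step
  obtain ⟨μ, hμ, hμ0, hμA, hμV⟩ := exists_continuous_lt_dyadic_imp_mem hA hV hAV
  have hμV' : ∀ n z, μ z ∈ Icc (r (n + 1)) (r n) → z ∈ V n := fun n z hz =>
    hμV n z (by have := hrpos n; have := hz.2; simp only [hr] at *; linarith)
  have hidx : ∀ t : ℝ, 0 < t → t < 1 → ∃ n, r (n + 1) ≤ t ∧ t < r n := fun t h0 h1 => by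
    obtain ⟨n, hn1, hn2⟩ := exists_nat_pow_near_of_lt_one h0 h1.le
      (show (0 : ℝ) < 1 / 2 by norm_num) (by norm_num)
    rcases hn2.lt_or_eq with h | h
    · exact ⟨n, hn1.le, h⟩
    · cases n with
      | zero => simp [h] at h1
      | succ n => exact ⟨n, h.ge, h.trans_lt (hrlt n)⟩
  have hranti : StrictAnti r := strictAnti_nat_of_succ_lt hrlt
  have hcompat : ∀ n m z, n < m → μ z ∈ Icc (r (n + 1)) (r n) → μ z ∈ Icc (r (m + 1)) (r m) →
      G n (z, μ z) = G m (z, μ z) := by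
    intro n m z hnm hn hm
    have h1 : r (n + 1) = r m := le_antisymm (hn.1.trans hm.2) (hranti.antitone hnm)
    obtain rfl : n + 1 = m := hranti.injective h1
    have h2 : μ z = r (n + 1) := le_antisymm hm.2 hn.1
    have h3 := hG0 n z (hμV' n z hn)
    have h4 := hG1 (n + 1) z (hμV' _ z hm)
    rw [h2, h3, h4]
  choose! idx hidx1 hidx2 using hidx
  classical
  -- The homotopies `G n` are strung together, with `μ z` as the time parameter; `μ` is so small
  -- that `z` lies in the domain of the homotopy in use. Times start at `r 0 = 1`, so the extension
  -- is defined where `μ < 1`.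
  let Φ : Z → E := fun z => if μ z = 0 then f z else G (idx (μ z)) (z, μ z)
  have hΦA : EqOn Φ f A := fun z hz => if_pos ((hμA z).2 hz)
  have hΦG : ∀ n z, μ z < 1 → μ z ∈ Icc (r (n + 1)) (r n) → Φ z = G n (z, μ z) := by
    intro n z h1 hn
    have hpos : 0 < μ z := (hrpos _).trans_le hn.1
    have hm : μ z ∈ Icc (r (idx (μ z) + 1)) (r (idx (μ z))) :=
      ⟨hidx1 _ hpos h1, (hidx2 _ hpos h1).le⟩
    have : Φ z = G (idx (μ z)) (z, μ z) := if_neg hpos.ne'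
    rw [this]
    rcases lt_trichotomy n (idx (μ z)) with h | h | h
    · exact (hcompat _ _ z h hn hm).symm
    · rw [← h]
    · exact hcompat _ _ z h hm hn
  have hUo : IsOpen {z | μ z < 1} := isOpen_lt hμ continuous_const
  refine ⟨{z | μ z < 1}, hUo, fun a ha => by simp [(hμA a).2 ha], Φ, fun z hz => ?_,
    fun z hz => ?_, hΦA⟩
  · apply ContinuousAt.continuousWithinAt
    rcases (hμ0 z).eq_or_lt with h0 | hpos
    · have hzA := (hμA z).1 h0.symm
      rw [Metric.continuousAt_iff]
      intro ε hε
      have hc := hcH2 (z, 0) ⟨hzA, trivial⟩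
      obtain ⟨δ, hδ, h⟩ := Metric.continuousWithinAt_iff.1 hc (ε / 2) (by positivity)
      simp only [hH0] at h
      have hμc : ∀ᶠ y in 𝓝 z, 2 * μ y < min (δ / 2) (ε / 2) ∧ μ y < 1 := by
        refine (ContinuousAt.eventually_lt (by fun_prop) (by fun_prop) ?_).and
          (ContinuousAt.eventually_lt (by fun_prop) (by fun_prop) ?_)
        · rw [← h0]; simp [hδ, hε]
        · rw [← h0]; simp
      obtain ⟨η, hη, hη'⟩ := Metric.eventually_nhds_iff.1 hμc
      refine ⟨min η (δ / 2), by positivity, fun {y} hy => ?_⟩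
      obtain ⟨hy1, hy2⟩ := hη' (hy.trans_le (min_le_left _ _))
      have hy3 := hy.trans_le (min_le_right _ _)
      rw [hΦA hzA]
      rcases (hμ0 y).eq_or_lt with hy0 | hy0
      · have hyA := (hμA y).1 hy0.symm
        rw [hΦA hyA]
        have := h (x := (y, 0)) ⟨hyA, trivial⟩ (by
          rw [Prod.dist_eq, dist_self, max_lt_iff]; exact ⟨by linarith, hδ⟩)
        rw [hH0] at this
        linarith
      · have hI : μ y ∈ Icc (r (idx (μ y) + 1)) (r (idx (μ y))) :=
          ⟨hidx1 _ hy0 hy2, (hidx2 _ hy0 hy2).le⟩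
        rw [hΦG _ y hy2 hI]
        obtain ⟨a, ha, h1, h2⟩ := hGH _ y (hμV' _ y hI) (μ y) hI
        -- The closeness `r n` is at most twice the time, so it tends to zero on approach to `A`;
        -- this gives continuity at points of `A`.
        have h3 : r (idx (μ y)) ≤ 2 * μ y := by have := hI.1; rw [hrsucc] at this; linarith
        have h4 := min_le_left (δ / 2) (ε / 2)
        have h5 := min_le_right (δ / 2) (ε / 2)
        have := h (x := (a, μ y)) ⟨ha, trivial⟩ (by
          rw [Prod.dist_eq, max_lt_iff]
          refine ⟨?_, ?_⟩
          · have := dist_triangle a y z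
            rw [dist_comm a y] at this
            show dist a z < δ
            linarith
          · rw [Real.dist_eq]
            show |μ y - 0| < δ
            rw [sub_zero, abs_of_pos hy0]
            linarith)
        have h6 := dist_triangle (G (idx (μ y)) (y, μ y)) (H (μ y, f a)) (f z)
        linarith
    · obtain ⟨n, hn1, hn2⟩ : ∃ n, r (n + 1) ≤ μ z ∧ μ z < r n := ⟨_, hidx1 _ hpos hz, hidx2 _ hpos hz⟩
      have hpiece : ∀ k, ContinuousOn Φ {y | μ y < 1 ∧ μ y ∈ Icc (r (k + 1)) (r k)} := by
        intro k
        refine ContinuousOn.congr (f := fun y => G k (y, μ y)) ?_ fun y hy => hΦG k y hy.1 hy.2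
        exact (hG k).comp (by fun_prop) fun y hy => ⟨hμV' k y hy.2, hy.2⟩
      have hclosed : ∀ k, ContinuousWithinAt Φ {y | μ y < 1 ∧ μ y ∈ Icc (r (k + 1)) (r k)} z := by
        intro k
        by_cases hk : μ z ∈ Icc (r (k + 1)) (r k)
        · exact hpiece k z ⟨hz, hk⟩
        · refine continuousWithinAt_of_notMem_closure fun h => hk ?_
          exact closure_minimal (t := μ ⁻¹' Icc (r (k + 1)) (r k)) (fun y hy => hy.2)
            (isClosed_Icc.preimage hμ) h
      -- Two pieces suffice near `z`: the next one enters because `μ z` may equal `r (n + 1)`.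
      refine ((hclosed n).union (hclosed (n + 1))).continuousAt ?_
      have hlo : r (n + 1 + 1) < μ z := (hrlt _).trans_le hn1
      filter_upwards [hUo.mem_nhds hz, (hμ.tendsto z).eventually_lt_const hn2,
        (hμ.tendsto z).eventually_const_lt hlo] with y hy1 hy2 hy3
      rcases le_total (r (n + 1)) (μ y) with h | h
      · exact Or.inl ⟨hy1, h, hy2.le⟩
      · exact Or.inr ⟨hy1, hy3.le, h⟩
  · rcases (hμ0 z).eq_or_lt with h0 | hpos
    · have hzA := (hμA z).1 h0.symm
      rw [hΦA hzA]; exact hfN hzA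
    · have hI : μ z ∈ Icc (r (idx (μ z) + 1)) (r (idx (μ z))) :=
        ⟨hidx1 _ hpos hz, (hidx2 _ hpos hz).le⟩
      rw [hΦG _ z hz hI]
      exact hGN _ ⟨hμV' _ z hI, hI⟩

/-! ### Topology of the mapping cylinder -/

namespace MapCyl

variable {A B : Type u} [TopologicalSpace A] [TopologicalSpace B] (f : C(A, B))

theorem height_nonneg (z : MapCyl f) : 0 ≤ height f z := by
  cases z with
  | body a s => exact s.2.1.le
  | base b => exact le_rfl

theorem height_le_one (z : MapCyl f) : height f z ≤ 1 := by
  cases z with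
  | body a s => exact s.2.2
  | base b => exact zero_le_one

theorem isOpenEmbedding_body :
    IsOpenEmbedding (fun q : A × Ioc (0 : ℝ) 1 => (body q.1 q.2 : MapCyl f)) := by
  refine .of_continuous_injective_isOpenMap ⟨fun W hW => hW.1⟩ ?_ fun U hU => ⟨?_, ?_⟩
  · rintro ⟨a, s⟩ ⟨a', s'⟩ h
    cases h; rfl
  · convert hU
    ext q
    constructor
    · rintro ⟨⟨a, s⟩, hq, h⟩
      cases h; exact hq
    · exact fun hq => ⟨q, hq, rfl⟩
  · rintro b ⟨q, -, h⟩
    cases h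

theorem continuous_base : Continuous (base : B → MapCyl f) := by
  refine ⟨fun W hW => isOpen_iff_mem_nhds.2 fun b hb => ?_⟩
  obtain ⟨V, hV, hbV, ε, hε, h⟩ := hW.2 b hb
  exact mem_of_superset (hV.mem_nhds hbV) fun b' hb' => h _ hb' hε

theorem continuous_height : Continuous (height f) := by
  refine ⟨fun O hO => ⟨?_, fun b hb => ?_⟩⟩
  · exact hO.preimage (continuous_subtype_val.comp continuous_snd)
  · obtain ⟨ε, hε, h⟩ := Metric.isOpen_iff.1 hO 0 hb
    refine ⟨univ, isOpen_univ, trivial, ε, hε, fun z _ hz => h ?_⟩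
    rw [Metric.mem_ball, Real.dist_eq, sub_zero, abs_of_nonneg (height_nonneg f z)]
    exact hz

theorem continuous_proj : Continuous (proj f) := (retr f).continuous

theorem tendsto_nhds_base {ι : Type*} {l : Filter ι} {g : ι → MapCyl f} {b : B}
    (hp : Tendsto (fun i => proj f (g i)) l (𝓝 b))
    (hh : Tendsto (fun i => height f (g i)) l (𝓝 0)) : Tendsto g l (𝓝 (base b)) := by
  refine tendsto_nhds.2 fun W hW hb => ?_
  obtain ⟨V, hV, hbV, ε, hε, h⟩ := hW.2 b hb
  filter_upwards [hp (hV.mem_nhds hbV), hh.eventually_lt_const hε] with i h1 h2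
  exact h _ h1 h2

open Classical in
/-- The point of the mapping cylinder over `b` at height `t`, where `a` is the point of the fibre
over `b` to be used for `t > 0`. -/
noncomputable def mk (b : B) (a : A) (t : ℝ) : MapCyl f :=
  if h : t ∈ Ioc (0 : ℝ) 1 then body a ⟨t, h⟩ else base b

theorem mk_of_mem {b : B} {a : A} {t : ℝ} (h : t ∈ Ioc (0 : ℝ) 1) : mk f b a t = body a ⟨t, h⟩ :=
  dif_pos h

theorem mk_of_nonpos {b : B} {a : A} {t : ℝ} (h : t ≤ 0) : mk f b a t = base b :=
  dif_neg fun h' => h'.1.not_ge h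

theorem proj_mk {b : B} {a : A} {t : ℝ} (h : 0 < t → f a = b) : proj f (mk f b a t) = b := by
  by_cases ht : t ∈ Ioc (0 : ℝ) 1
  · rw [mk_of_mem f ht]; exact h ht.1
  · rw [mk, dif_neg ht]; rfl

theorem height_mk {b : B} {a : A} {t : ℝ} (h₀ : 0 ≤ t) (h₁ : t ≤ 1) :
    height f (mk f b a t) = t := by
  rcases h₀.eq_or_lt with h | h
  · rw [mk_of_nonpos f h.symm.le, ← h]; rfl
  · rw [mk_of_mem f ⟨h, h₁⟩]; rfl

theorem tendsto_mk_body {ι : Type*} {l : Filter ι} {b : ι → B} {x : ι → A} {t : ι → ℝ} {a : A}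
    {s : Ioc (0 : ℝ) 1} (ht1 : ∀ᶠ i in l, t i ≤ 1) (hx : Tendsto x l (𝓝 a))
    (ht : Tendsto t l (𝓝 s)) : Tendsto (fun i => mk f (b i) (x i) (t i)) l (𝓝 (body a s)) := by
  classical
  have hmem : ∀ᶠ i in l, t i ∈ Ioc (0 : ℝ) 1 := (ht.eventually_const_lt s.2.1).and ht1
  let σ : ι → Ioc (0 : ℝ) 1 := fun i => if h : t i ∈ Ioc (0 : ℝ) 1 then ⟨t i, h⟩ else s
  have hσ : Tendsto σ l (𝓝 s) := by
    rw [tendsto_subtype_rng]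
    refine ht.congr' ?_
    filter_upwards [hmem] with i hi
    simp only [σ, dif_pos hi]
  refine (((isOpenEmbedding_body f).continuous.tendsto (a, s)).comp (hx.prodMk_nhds hσ)).congr' ?_
  filter_upwards [hmem] with i hi
  simp only [Function.comp, σ, dif_pos hi, mk_of_mem f hi]

/-- Neighbourhoods of base points are described by projection and height alone, so the coordinate in
`A` has to be continuous only where the height is positive. -/
theorem continuousOn_mk {Z : Type*} [TopologicalSpace Z] {U : Set Z} {b : Z → B} {x : Z → A}
    {t : Z → ℝ} (hb : ContinuousOn b U) (ht : ContinuousOn t U) (ht0 : ∀ z ∈ U, 0 ≤ t z)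
    (ht1 : ∀ z ∈ U, t z ≤ 1) (hx : ContinuousOn x (U ∩ {z | 0 < t z}))
    (hfx : ∀ z ∈ U, 0 < t z → f (x z) = b z) :
    ContinuousOn (fun z => mk f (b z) (x z) (t z)) U := by
  intro z hz
  rw [ContinuousWithinAt]
  rcases (ht0 z hz).eq_or_lt with h0 | hpos
  · rw [mk_of_nonpos f h0.symm.le]
    refine tendsto_nhds_base f ?_ ?_
    · refine (hb z hz).congr' ?_
      filter_upwards [self_mem_nhdsWithin] with y hy
      exact (proj_mk f (hfx y hy)).symm
    · rw [h0]
      refine (ht z hz).congr' ?_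
      filter_upwards [self_mem_nhdsWithin] with y hy
      exact (height_mk f (ht0 y hy) (ht1 y hy)).symm
  · rw [mk_of_mem f ⟨hpos, ht1 z hz⟩]
    refine tendsto_mk_body f ?_ ?_ (ht z hz)
    · filter_upwards [self_mem_nhdsWithin] with y hy using ht1 y hy
    · refine (hx z ⟨hz, hpos⟩).mono_left (nhdsWithin_le_of_mem ?_)
      exact inter_mem self_mem_nhdsWithin ((ht z hz).eventually_const_lt hpos)

section comp

variable [Nonempty A]

/-- The projection of the mapping cylinder to `A`, away from the base. -/
noncomputable def comp : MapCyl f → A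
  | body a _ => a
  | base _ => Classical.arbitrary A

theorem mk_proj_comp_height (z : MapCyl f) : mk f (proj f z) (comp f z) (height f z) = z := by
  cases z with
  | body a s => exact mk_of_mem f s.2
  | base b => exact mk_of_nonpos f le_rfl

theorem map_comp {z : MapCyl f} (hz : 0 < height f z) : f (comp f z) = proj f z := by
  cases z with
  | body a s => rfl
  | base b => exact (lt_irrefl _ hz).elim

theorem continuousOn_comp : ContinuousOn (comp f) {z | 0 < height f z} := by
  intro z hz
  cases z with
  | body a s =>
    refine ContinuousAt.continuousWithinAt ?_
    exact ((isOpenEmbedding_body f).continuousAt_iff (f := fun q : A × Ioc (0 : ℝ) 1 =>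
      (body q.1 q.2 : MapCyl f)) (x := (a, s))).1 continuous_fst.continuousAt
  | base b => exact (lt_irrefl (0 : ℝ) hz).elim

end comp

theorem eq_base_of_isEmpty [IsEmpty A] (z : MapCyl f) : z = base (proj f z) := by
  cases z with
  | body a s => exact isEmptyElim a
  | base b => rfl

/-- A mapping cylinder is metrizable if its base is metrizable and its top embeds in the unit sphere
of a normed space. -/
theorem metrizableSpace [TopologicalSpace.MetrizableSpace B] {L : Type*} [NormedAddCommGroup L]
    [NormedSpace ℝ L] {κ : A → L} (hκ : IsEmbedding κ) (hκ1 : ∀ a, ‖κ a‖ = 1) :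
    TopologicalSpace.MetrizableSpace (MapCyl f) := by
  -- This is a cone coordinate. As `κ` has unit values, its norm is the height, and for positive
  -- height dividing by the norm recovers the point of `A`. Together with `proj` it embeds the
  -- cylinder in `B × L`.
  let vec : MapCyl f → L := fun z => match z with
    | body a s => (s : ℝ) • κ a
    | base _ => 0
  have hvec : ∀ z, ‖vec z‖ = height f z := by
    rintro (⟨a, s⟩ | b)
    · simp only [vec, height, norm_smul, hκ1, mul_one, Real.norm_of_nonneg s.2.1.le]
    · simp only [vec, height, norm_zero]
  have hvc : Continuous vec := by
    rw [continuous_iff_continuousAt]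
    rintro (⟨a, s⟩ | b)
    · refine ((isOpenEmbedding_body f).continuousAt_iff (f := fun q : A × Ioc (0 : ℝ) 1 =>
        (body q.1 q.2 : MapCyl f)) (x := (a, s))).1 (Continuous.continuousAt ?_)
      exact (continuous_subtype_val.comp continuous_snd).smul (hκ.continuous.comp continuous_fst)
    · rw [ContinuousAt, show vec (base b) = 0 from rfl, tendsto_zero_iff_norm_tendsto_zero]
      simp only [hvec]
      exact (continuous_height f).tendsto (base b)
  let J : MapCyl f → B × L := fun z => (proj f z, vec z)
  have hJc : Continuous J := (continuous_proj f).prodMk hvc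
  suffices IsEmbedding J from this.metrizableSpace
  refine ⟨isInducing_iff_nhds.2 fun z => le_antisymm (hJc.tendsto z).le_comap ?_, ?_⟩
  · change Tendsto (fun z => z) (comap J (𝓝 (J z))) (𝓝 z)
    have h1 : Tendsto (proj f) (comap J (𝓝 (J z))) (𝓝 (proj f z)) :=
      (continuous_fst.tendsto (J z)).comp tendsto_comap
    have h2 : Tendsto vec (comap J (𝓝 (J z))) (𝓝 (vec z)) :=
      (continuous_snd.tendsto (J z)).comp tendsto_comap
    have h3 : Tendsto (height f) (comap J (𝓝 (J z))) (𝓝 (height f z)) := by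
      simpa only [hvec] using h2.norm
    cases z with
    | base b => exact tendsto_nhds_base f h1 h3
    | body a s =>
      have : Nonempty A := ⟨a⟩
      have key := tendsto_mk_body f (b := proj f) (x := comp f) (t := height f) (a := a) (s := s)
        (l := comap J (𝓝 (J (body a s)))) (Eventually.of_forall (height_le_one f)) ?_ h3
      · simpa only [mk_proj_comp_height] using key
      · rw [hκ.isInducing.tendsto_nhds_iff]
        have h4 : Tendsto (fun z => (height f z)⁻¹ • vec z) (comap J (𝓝 (J (body a s))))
            (𝓝 ((s : ℝ)⁻¹ • (s : ℝ) • κ a)) := (h3.inv₀ s.2.1.ne').smul h2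
        rw [inv_smul_smul₀ s.2.1.ne'] at h4
        refine h4.congr' ?_
        filter_upwards [h3.eventually_const_lt s.2.1] with y hy
        cases y with
        | base b => exact (lt_irrefl _ hy).elim
        | body a' s' => exact inv_smul_smul₀ s'.2.1.ne' _
  · rintro z z' h
    have hv : vec z = vec z' := congrArg Prod.snd h
    have hp : proj f z = proj f z' := congrArg Prod.fst h
    have hh : height f z = height f z' := by rw [← hvec, ← hvec, hv]
    cases z with
    | base b =>
      cases z' with
      | base b' => exact congrArg base hp
      | body a' s' => exact (s'.2.1.ne hh).elim
    | body a s =>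
      cases z' with
      | base b' => exact (s.2.1.ne' hh).elim
      | body a' s' =>
        obtain rfl : s = s' := Subtype.ext hh
        have := smul_right_injective L s.2.1.ne' hv
        rw [hκ.injective this]

/-- A subset of the mapping cylinder that lies over a compact subset of the base, and under
the graph of a function on the top that is proper over `(0, ∞)`, is compact. -/
theorem isCompact_setOf_le [T2Space B] {B' : Set B} (hB' : IsCompact B') {φ : A → ℝ} (hφ : Continuous φ)
    (hφc : ∀ δ > 0, IsCompact {a | δ ≤ φ a}) :
    IsCompact {z : MapCyl f | proj f z ∈ B' ∧ ∀ a s, z = body a s → s ≤ φ a} := by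
  rw [isCompact_iff_ultrafilter_le_nhds']
  intro l hl
  obtain ⟨b, hb, hlb⟩ := isCompact_iff_ultrafilter_le_nhds'.1 hB' (l.map (proj f))
    (Filter.mem_of_superset (f := (l : Filter (MapCyl f))) hl fun z hz => hz.1)
  obtain ⟨t, ht, hlt⟩ := isCompact_iff_ultrafilter_le_nhds'.1
    (isCompact_Icc (a := (0 : ℝ)) (b := 1)) (l.map (height f))
    (Eventually.of_forall (f := (l : Filter (MapCyl f)))
      fun z => ⟨height_nonneg f z, height_le_one f z⟩)
  replace hlt : Tendsto (height f) l (𝓝 t) := hlt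
  rcases ht.1.eq_or_lt with h0 | hpos
  · exact ⟨base b, ⟨hb, fun a s h => by cases h⟩, tendsto_nhds_base f hlb (h0 ▸ hlt)⟩
  · have hev : ∀ᶠ z in (l : Filter (MapCyl f)), t / 2 < height f z :=
      Tendsto.eventually_const_lt (f := height f) (half_lt_self hpos) hlt
    rcases isEmpty_or_nonempty A with hA | hA
    · obtain ⟨z, hz⟩ := hev.exists
      rw [eq_base_of_isEmpty f z] at hz
      exact absurd hz (not_lt.2 (half_pos hpos).le)
    -- When the limit height `t` is positive, the heights eventually exceed `t / 2`, so the
    -- coordinates in `A` stay in the compact set `{t / 2 ≤ φ}`.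
    obtain ⟨a, ha, hla⟩ := isCompact_iff_ultrafilter_le_nhds'.1 (hφc (t / 2) (half_pos hpos))
      (l.map (comp f)) (by
        change ∀ᶠ z in (l : Filter (MapCyl f)), t / 2 ≤ φ (comp f z)
        filter_upwards [hl, hev] with z hz hz'
        cases z with
        | base b => exact absurd hz' (not_lt.2 (half_pos hpos).le)
        | body a s => exact hz'.le.trans (hz.2 a s rfl))
    replace hla : Tendsto (comp f) l (𝓝 a) := hla
    have key := tendsto_mk_body f (b := proj f) (x := comp f) (t := height f) (a := a)
      (s := ⟨t, hpos, ht.2⟩) (l := l) (Eventually.of_forall (height_le_one f)) hla hlt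
    simp only [mk_proj_comp_height] at key
    refine ⟨_, ⟨?_, ?_⟩, key⟩
    · have := tendsto_nhds_unique (((continuous_proj f).tendsto _).comp key) hlb
      rwa [← this] at hb
    · rintro a' s' h
      cases h
      refine le_of_tendsto_of_tendsto hlt ((hφ.tendsto a).comp hla) ?_
      filter_upwards [hl, hev] with z hz hz'
      cases z with
      | base b => exact absurd hz' (not_lt.2 (half_pos hpos).le)
      | body a s => exact hz.2 a s rfl

end MapCyl

/-! ### Mapping cylinders as neighbourhood extensors -/

theorem eventually_forall_Icc_lt {Z : Type*} [TopologicalSpace Z] {V : Set Z} (hV : IsOpen V)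
    {α β : ℝ} {k : Z × ℝ → ℝ} (hk : ContinuousOn k (V ×ˢ Icc α β)) {w : Z → ℝ} {a : Z}
    (hw : ContinuousAt w a) (ha : a ∈ V) (h : ∀ s ∈ Icc α β, k (a, s) < w a) :
    ∀ᶠ z in 𝓝 a, ∀ s ∈ Icc α β, k (z, s) < w z := by
  have hev : ∀ s ∈ Icc α β, ∀ᶠ q : Z × ℝ in 𝓝 (a, s), q.2 ∈ Icc α β → k q < w q.1 := by
    intro s hs
    have h1 : ContinuousWithinAt (fun q : Z × ℝ => w q.1) (V ×ˢ Icc α β) (a, s) :=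
      (hw.comp (x := (a, s)) continuous_fst.continuousAt).continuousWithinAt
    have h2 := Tendsto.eventually_lt (hk (a, s) ⟨ha, hs⟩) h1 (h s hs)
    filter_upwards [eventually_nhdsWithin_iff.1 h2,
      continuous_fst.continuousAt.eventually_mem (hV.mem_nhds ha)] with q hq1 hq2 hq
    exact hq1 ⟨hq2, hq⟩
  filter_upwards [isCompact_Icc.eventually_forall_of_forall_eventually
    (P := fun z s => s ∈ Icc α β → k (z, s) < w z) hev] with z hz s hs
  exact hz s hs hs

/-- Urysohn's lemma relative to an open subset of a metrizable space. -/
theorem exists_continuousOn_zero_one {Z : Type*} [TopologicalSpace Z]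
    [TopologicalSpace.MetrizableSpace Z] {V V' C : Set Z} (hV' : IsOpen V')
    (hC : IsClosed C) (h : V ∩ C ⊆ V') :
    ∃ ψ : Z → ℝ, ContinuousOn ψ V ∧ (∀ z, 0 ≤ ψ z) ∧ (∀ z, ψ z ≤ 1) ∧ (∀ z ∈ V ∩ C, ψ z = 1) ∧
      ∀ z ∈ V, z ∉ V' → ∀ᶠ y in 𝓝 z, ψ y = 0 := by
  obtain ⟨φ, hφ0, hφ1, hφ⟩ := exists_continuous_zero_one_of_isClosed
    (hV'.isClosed_compl.preimage (continuous_subtype_val (p := (· ∈ V))))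
    (hC.preimage (continuous_subtype_val (p := (· ∈ V))))
    (Set.disjoint_left.2 fun z hz hz' => hz (h ⟨z.2, hz'⟩))
  classical
  -- Truncating at `φ = 1 / 2` makes the function vanish near each point of `V` outside `V'`, not
  -- only at that point.
  refine ⟨fun z => if h : z ∈ V then max (2 * φ ⟨z, h⟩ - 1) 0 else 0, ?_, fun z => ?_, fun z => ?_,
    fun z hz => ?_, fun z hz hz' => ?_⟩
  · rw [continuousOn_iff_continuous_domRestrict]
    refine Continuous.congr (f := fun z => max (2 * φ z - 1) 0) (by fun_prop) fun z => ?_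
    simp [Set.domRestrict]
  · dsimp only
    split_ifs
    exacts [le_max_right _ _, le_rfl]
  · dsimp only
    split_ifs with h
    · have := (hφ ⟨z, h⟩).2
      exact max_le (by linarith) zero_le_one
    · exact zero_le_one
  · have : φ ⟨z, hz.1⟩ = 1 := hφ1 hz.2
    simp only [dif_pos hz.1, this]
    norm_num
  · have h0 : φ ⟨z, hz⟩ = 0 := hφ0 hz'
    have : ∀ᶠ y : V in 𝓝 ⟨z, hz⟩, φ y < 1 / 2 :=
      (φ.continuous.tendsto _).eventually_lt_const (by rw [h0]; norm_num)
    rw [nhds_subtype_eq_comap, eventually_comap] at this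
    filter_upwards [this] with y hy
    split_ifs with hyV
    · have := hy ⟨y, hyV⟩ rfl
      exact max_eq_right (by linarith)
    · rfl

/-- The part of a mapping cylinder that lies over an absolute neighbourhood extensor in the base,
and under the graph of a function on the top, is an absolute neighbourhood extensor. -/
theorem MapCyl.isANESet_setOf_le {A B : Type u} [TopologicalSpace A] [TopologicalSpace B]
    [TopologicalSpace.MetrizableSpace B] (f : C(A, B)) {B' : Set B} (hB : IsANESet B') {φ : A → ℝ}
    (hφ : Continuous φ) (hA : IsANESet {a | 0 < φ a}) (hfB : ∀ a, 0 < φ a → f a ∈ B') :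
    IsANESet {z : MapCyl f | proj f z ∈ B' ∧ ∀ a s, z = body a s → s ≤ φ a} := by
  intro Z _ _ D g hD hg hgW
  let _ := TopologicalSpace.metrizableSpaceMetric B
  have hpg : ContinuousOn (fun z => proj f (g z)) D := (continuous_proj f).comp_continuousOn hg
  obtain ⟨U, hU, hDU, G, hG, hGB, hGg⟩ := hB Z D (fun z => proj f (g z)) hD hpg
    fun z hz => (hgW hz).1
  rcases isEmpty_or_nonempty A with hemp | hne
  · refine ⟨U, hU, hDU, fun z => base (G z), (continuous_base f).comp_continuousOn hG,
      fun z hz => ⟨hGB hz, fun a => isEmptyElim a⟩, fun z hz => ?_⟩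
    dsimp only
    rw [eq_base_of_isEmpty f (g z), hGg hz]
  -- The three coordinates of `g` are extended separately: the projection to `G`, the height to `T`,
  -- and, only where `T > 0`, the coordinate in `A` to `X`. In general `f ∘ X` and `G` agree only on
  -- `D`; the homotopy `K` between them repairs this.
  obtain ⟨T, hT, hT01, hTg⟩ := exists_continuous_extension_convex hD
    ((continuous_height f).comp_continuousOn hg) (convex_Icc (0 : ℝ) 1) ⟨0, by simp⟩
    fun z _ => ⟨height_nonneg f _, height_le_one f _⟩
  have hV₁ : IsOpen (U ∩ {z | 0 < T z}) := hU.inter (isOpen_lt continuous_const hT)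
  set V₁ := U ∩ {z | 0 < T z}
  have hD₁ : ∀ z ∈ V₁ ∩ D, 0 < height f (g z) := fun z hz => by
    have : T z = height f (g z) := hTg hz.2
    exact this ▸ hz.1.2
  obtain ⟨V₂, hV₂, hDV₂, hV₂₁, X, hX, hXA, hXg⟩ := hA.exists_extension_of_isOpen hV₁ hD
    (f := fun z => comp f (g z))
    ((continuousOn_comp f).comp (hg.mono inter_subset_right) hD₁) fun z hz => by
      have h1 := hD₁ z hz
      have h2 := (hgW hz.2).2
      dsimp only
      cases h : g z with
      | base b => rw [h] at h1; exact (lt_irrefl (0 : ℝ) h1).elim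
      | body a s => exact s.2.1.trans_le (h2 a s h)
  have hsub₂ : V₂ ∩ D ⊆ V₁ ∩ D := inter_subset_inter_left _ hV₂₁
  obtain ⟨V₃, hV₃, hDV₃, hV₃₂, K, hK, hKB, hK0, hK1, hKg⟩ := hB.exists_homotopy hV₂ hD zero_lt_one
    (g₀ := G) (g₁ := fun z => f (X z)) (H := fun q => proj f (g q.1))
    (hG.mono fun z hz => (hV₂₁ hz).1) (f.continuous.comp_continuousOn hX)
    (fun z hz => hGB (hV₂₁ hz).1) (fun z hz => hfB _ (hXA hz))
    (hpg.comp continuous_fst.continuousOn fun q hq => hq.1.2)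
    (fun q hq => (hgW hq.1.2).1) (fun z hz => (hGg hz.2).symm)
    (fun z hz => by
      have := hXg (hsub₂ hz)
      simp only [this, map_comp f (hD₁ z (hsub₂ hz))])
  -- Requiring `K` to move points by less than `T` keeps the corrected projection continuous where
  -- `T` vanishes.
  let V₄ := interior {z | z ∈ V₃ ∧ ∀ s ∈ Icc (0 : ℝ) 1, dist (K (z, s)) (G z) < T z}
  have hV₄ : IsOpen V₄ := isOpen_interior
  have hV₄' : ∀ z ∈ V₄, z ∈ V₃ ∧ ∀ s ∈ Icc (0 : ℝ) 1, dist (K (z, s)) (G z) < T z :=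
    fun z hz => interior_subset (s := {z | z ∈ V₃ ∧ ∀ s ∈ Icc (0 : ℝ) 1, _}) hz
  have hV₃U : ∀ z ∈ V₃, z ∈ U := fun z hz => (hV₂₁ (hV₃₂ hz)).1
  have hDV₄ : V₁ ∩ D ⊆ V₄ := by
    intro z hz
    have hz₃ : z ∈ V₃ := hDV₃ ⟨hDV₂ hz, hz.2⟩
    rw [mem_interior_iff_mem_nhds]
    refine inter_mem (hV₃.mem_nhds hz₃) ?_
    refine eventually_forall_Icc_lt hV₃ (k := fun q => dist (K q) (G q.1))
      (continuous_dist.comp_continuousOn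
        (hK.prodMk (hG.comp continuous_fst.continuousOn fun q hq => hV₃U _ hq.1)))
      hT.continuousAt hz₃ fun s hs => ?_
    dsimp only
    rw [hKg ⟨⟨hDV₂ hz, hz.2⟩, hs⟩, hGg hz.2, dist_self]
    exact hz.1.2
  obtain ⟨ψ, hψ, hψ0, hψ1, hψD, hψV⟩ := exists_continuousOn_zero_one hV₄ hD hDV₄
  have hV₄₁ : V₄ ⊆ V₁ := fun z hz => hV₂₁ (hV₃₂ (hV₄' z hz).1)
  classical
  -- As `ψ` grows from `0` to `1 / 2`, the projection moves along `K` from `G` to `f ∘ X` at height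
  -- zero. Only after that, for `ψ` from `1 / 2` to `1`, does the height rise, so a point of
  -- positive height has projection exactly `f (X z)`. The minimum with `φ (X z)` keeps it under the
  -- graph.
  let b : Z → B := fun z => if z ∈ V₄ then K (z, min (2 * ψ z) 1) else G z
  let t : Z → ℝ := fun z => if z ∈ V₄ then min (T z * max (2 * ψ z - 1) 0) (φ (X z)) else 0
  have hmin : ∀ z, min (2 * ψ z) 1 ∈ Icc (0 : ℝ) 1 := fun z =>
    ⟨le_min (by linarith [hψ0 z]) zero_le_one, min_le_right _ _⟩
  have hmax : ∀ z, max (2 * ψ z - 1) 0 ≤ 1 := fun z =>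
    max_le (by linarith [hψ1 z]) zero_le_one
  have hb4 : ∀ z ∈ V₄, b z = K (z, min (2 * ψ z) 1) := fun z hz => if_pos hz
  have ht4 : ∀ z ∈ V₄, t z = min (T z * max (2 * ψ z - 1) 0) (φ (X z)) := fun z hz => if_pos hz
  have hφX : ∀ z ∈ V₄, 0 < φ (X z) := fun z hz => hXA (hV₃₂ (hV₄' z hz).1)
  have hT0 : ∀ z, 0 ≤ T z := fun z => (hT01 z).1
  have ht0 : ∀ z, 0 ≤ t z := fun z => by
    by_cases hz : z ∈ V₄
    · rw [ht4 z hz]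
      exact le_min (mul_nonneg (hT0 z) (le_max_right _ _)) (hφX z hz).le
    · simp [t, hz]
  have htT : ∀ z, t z ≤ T z := fun z => by
    by_cases hz : z ∈ V₄
    · rw [ht4 z hz]
      exact (min_le_left _ _).trans (mul_le_of_le_one_right (hT0 z) (hmax z))
    · simpa [t, hz] using hT0 z
  have hbG : ∀ z, dist (G z) (b z) ≤ T z := fun z => by
    by_cases hz : z ∈ V₄
    · rw [hb4 z hz, dist_comm]
      exact ((hV₄' z hz).2 _ (hmin z)).le
    · simpa [b, hz] using hT0 z
  have hψ4 : ContinuousOn ψ V₄ := hψ.mono hV₄₁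
  have hbc : ContinuousOn b U := by
    intro z hz
    by_cases hz4 : z ∈ V₄
    · refine ContinuousAt.continuousWithinAt ?_
      refine (ContinuousOn.congr (f := fun z => K (z, min (2 * ψ z) 1)) ?_ hb4).continuousAt
        (hV₄.mem_nhds hz4)
      exact hK.comp (by fun_prop) fun y hy => ⟨(hV₄' y hy).1, hmin y⟩
    have hbz : b z = G z := if_neg hz4
    rw [ContinuousWithinAt, hbz]
    rcases (hT0 z).eq_or_lt with h0 | hpos
    · refine (hG z hz).congr_dist (squeeze_zero (fun _ => dist_nonneg) hbG ?_)
      rw [h0]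
      exact hT.continuousWithinAt
    · refine (hG z hz).congr' (eventually_nhdsWithin_of_eventually_nhds ?_)
      filter_upwards [hψV z ⟨hz, hpos⟩ hz4] with y hy
      by_cases hy4 : y ∈ V₄
      · rw [hb4 y hy4, hy, mul_zero, min_eq_left zero_le_one, hK0 y (hV₄' y hy4).1]
      · exact (if_neg hy4).symm
  have htc : ContinuousOn t U := by
    intro z hz
    by_cases hz4 : z ∈ V₄
    · refine ContinuousAt.continuousWithinAt ?_
      refine (ContinuousOn.congr ?_ ht4).continuousAt (hV₄.mem_nhds hz4)
      have h1 : ContinuousOn (fun z => T z * max (2 * ψ z - 1) 0) V₄ := by fun_prop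
      exact continuous_min.comp_continuousOn
        (h1.prodMk (hφ.comp_continuousOn (hX.mono fun y hy => hV₃₂ (hV₄' y hy).1)))
    have htz : t z = 0 := if_neg hz4
    rw [ContinuousWithinAt, htz]
    rcases (hT0 z).eq_or_lt with h0 | hpos
    · refine squeeze_zero ht0 htT ?_
      rw [h0]
      exact hT.continuousWithinAt
    · refine tendsto_const_nhds.congr' (eventually_nhdsWithin_of_eventually_nhds ?_)
      filter_upwards [hψV z ⟨hz, hpos⟩ hz4] with y hy
      by_cases hy4 : y ∈ V₄
      · rw [ht4 y hy4, hy, mul_zero, max_eq_right (by norm_num), mul_zero,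
          min_eq_left (hφX y hy4).le]
      · exact (if_neg hy4).symm
  have ht_mem : ∀ z, 0 < t z → z ∈ V₄ := fun z hz => by
    by_contra h
    simp [t, h] at hz
  have hfX : ∀ z ∈ U, 0 < t z → f (X z) = b z := by
    intro z _ hz
    have hz4 := ht_mem z hz
    have h1 : 0 < T z * max (2 * ψ z - 1) 0 :=
      (lt_min_iff.1 (ht4 z hz4 ▸ hz)).1
    have h2 : 0 < max (2 * ψ z - 1) 0 := pos_of_mul_pos_right h1 (hT0 z)
    have h3 : 0 < 2 * ψ z - 1 := (lt_max_iff.1 h2).resolve_right (lt_irrefl 0)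
    rw [hb4 z hz4, min_eq_right (by linarith), hK1 z (hV₄' z hz4).1]
  have ht1 : ∀ z ∈ U, t z ≤ 1 := fun z _ => (htT z).trans (hT01 z).2
  refine ⟨U, hU, hDU, fun z => mk f (b z) (X z) (t z), continuousOn_mk f hbc htc
    (fun z _ => ht0 z) ht1 (hX.mono fun z hz => hV₃₂ (hV₄' z (ht_mem z hz.2)).1) hfX,
    fun z hz => ⟨?_, ?_⟩, fun z hz => ?_⟩
  · dsimp only
    rw [proj_mk f (hfX z hz)]
    by_cases hz4 : z ∈ V₄
    · rw [hb4 z hz4]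
      exact hKB ⟨(hV₄' z hz4).1, hmin z⟩
    · simpa [b, hz4] using hGB hz
  · intro a s h
    dsimp only at h
    rcases (ht0 z).eq_or_lt with h0 | hpos
    · rw [mk_of_nonpos f h0.symm.le] at h
      cases h
    · rw [mk_of_mem f ⟨hpos, ht1 z hz⟩] at h
      cases h
      exact (ht4 z (ht_mem z hpos)).trans_le (min_le_right _ _)
  · have hTz : T z = height f (g z) := hTg hz
    rw [← mk_proj_comp_height f (g z)]
    rcases (hT0 z).eq_or_lt with h0 | hpos
    · have h4 : z ∉ V₄ := fun h => (hV₄₁ h).2.ne h0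
      simp only [b, t, if_neg h4]
      rw [← hTz, ← h0, mk_of_nonpos f le_rfl, mk_of_nonpos f le_rfl, hGg hz]
    · have hz1 : z ∈ V₁ ∩ D := ⟨⟨hDU hz, hpos⟩, hz⟩
      have h4 : z ∈ V₄ := hDV₄ hz1
      have hle : height f (g z) ≤ φ (X z) := by
        have hX' : X z = comp f (g z) := hXg hz1
        have h2 := (hgW hz).2
        rw [hX']
        cases h : g z with
        | base b => rw [hTz, h] at hpos; exact (lt_irrefl (0 : ℝ) hpos).elim
        | body a s => exact h2 a s h
      have htz : t z = height f (g z) := by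
        rw [ht4 z h4, hψD z hz1, hTz]
        norm_num
        exact hle
      have hbz : b z = proj f (g z) := by
        rw [← hfX z (hDU hz) (by rw [htz, ← hTz]; exact hpos)]
        have hX' : X z = comp f (g z) := hXg hz1
        rw [hX', map_comp f (hD₁ z hz1)]
      have hX' : X z = comp f (g z) := hXg hz1
      simp only [htz, hbz, hX']

/-! ### Simplicial complexes with the metric topology -/

section Realization

variable {V : Type u}

theorem norm_eq_sum_of_forall_notMem {x : lp (fun _ : V => ℝ) 1} {s : Finset V}
    (h : ∀ v, v ∉ s → x v = 0) : ‖x‖ = ∑ v ∈ s, |x v| := by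
  rw [lp.norm_eq_tsum_rpow (by simp), tsum_eq_sum (s := s) fun v hv => by simp [h v hv]]
  simp

theorem norm_eq_one_of_mem_realization {K : PreAbstractSimplicialComplex V}
    {x : lp (fun _ : V => ℝ) 1} (hx : x ∈ realization K) : ‖x‖ = 1 := by
  obtain ⟨h0, s, -, hs, h1⟩ := hx
  rw [norm_eq_sum_of_forall_notMem hs, ← h1]
  exact Finset.sum_congr rfl fun v _ => abs_of_nonneg (h0 v)

/-- Subtract `|c|` from all coordinates and take the positive part. -/
noncomputable def subPosPart (x : lp (fun _ : V => ℝ) 1) (c : ℝ) : lp (fun _ : V => ℝ) 1 :=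
  ⟨fun v => max (x v - |c|) 0, by
    have hx := (lp.memℓp x).summable (by simp)
    refine memℓp_gen (Summable.of_nonneg_of_le (fun v => by positivity) (fun v => ?_) hx)
    refine Real.rpow_le_rpow (norm_nonneg _) ?_ (by simp)
    rw [Real.norm_of_nonneg (le_max_right _ _)]
    exact max_le (by linarith [le_abs_self (x v), abs_nonneg c, Real.norm_eq_abs (x v)])
      (norm_nonneg _)⟩

theorem subPosPart_apply (x : lp (fun _ : V => ℝ) 1) (c : ℝ) (v : V) :
    subPosPart x c v = max (x v - |c|) 0 := rfl

/-- Off the finite support of `x` the truncated coordinate of `y` is at most `|y v|`, which is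
already counted in `‖y - x‖`. Only the coordinates in `s` feel the change of the constant, hence the
factor `s.card`. -/
theorem norm_subPosPart_sub_le {x y : lp (fun _ : V => ℝ) 1} {s : Finset V}
    (h : ∀ v, v ∉ s → x v = 0) (c d : ℝ) :
    ‖subPosPart y d - subPosPart x c‖ ≤ ‖y - x‖ + s.card * |d - c| := by
  classical
  refine lp.norm_le_of_forall_sum_le (by simp) (by positivity) fun t => ?_
  simp only [ENNReal.toReal_one, Real.rpow_one]
  have h1 : ∀ v, ‖(subPosPart y d - subPosPart x c) v‖ ≤
      ‖(y - x) v‖ + if v ∈ s then |d - c| else 0 := by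
    intro v
    rw [lp.coeFn_sub, lp.coeFn_sub, Pi.sub_apply, Pi.sub_apply, subPosPart_apply, subPosPart_apply,
      Real.norm_eq_abs, Real.norm_eq_abs]
    split_ifs with hv
    · have h2 := abs_max_sub_max_le_abs (y v - |d|) (x v - |c|) 0
      have h3 : |y v - |d| - (x v - |c|)| ≤ |y v - x v| + |(|d| - |c|)| := by
        rw [show y v - |d| - (x v - |c|) = (y v - x v) - (|d| - |c|) by ring]
        exact abs_sub _ _
      linarith [abs_abs_sub_abs_le d c]
    · rw [h v hv, max_eq_right (show 0 - |c| ≤ 0 by linarith [abs_nonneg c]), sub_zero, sub_zero,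
        abs_of_nonneg (le_max_right _ _), add_zero]
      exact max_le (by linarith [le_abs_self (y v), abs_nonneg d]) (abs_nonneg _)
  calc ∑ v ∈ t, ‖(subPosPart y d - subPosPart x c) v‖
      ≤ ∑ v ∈ t, (‖(y - x) v‖ + if v ∈ s then |d - c| else 0) := Finset.sum_le_sum fun v _ => h1 v
    _ = ∑ v ∈ t, ‖(y - x) v‖ + ((t.filter (· ∈ s)).card : ℝ) * |d - c| := by
      rw [Finset.sum_add_distrib, ← Finset.sum_filter, Finset.sum_const, nsmul_eq_mul]
    _ ≤ ‖y - x‖ + s.card * |d - c| := by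
      have h2 := lp.sum_rpow_le_norm_rpow (p := 1) (by simp) (y - x) t
      simp only [ENNReal.toReal_one, Real.rpow_one] at h2
      have h3 : (t.filter (· ∈ s)).card ≤ s.card :=
        Finset.card_le_card fun v hv => (Finset.mem_filter.1 hv).2
      gcongr

theorem continuous_subPosPart {Z : Type*} [TopologicalSpace Z] {F : Z → lp (fun _ : V => ℝ) 1}
    {c : Z → ℝ} (hF : Continuous F) (hc : Continuous c)
    (hfin : ∀ z, ∃ s : Finset V, ∀ v, v ∉ s → F z v = 0) :
    Continuous fun z => subPosPart (F z) (c z) := by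
  rw [continuous_iff_continuousAt]
  intro z
  obtain ⟨s, hs⟩ := hfin z
  rw [ContinuousAt, tendsto_iff_norm_sub_tendsto_zero]
  refine squeeze_zero (fun _ => norm_nonneg _) (fun y => norm_subPosPart_sub_le hs (c z) (c y)) ?_
  have : Continuous fun y => ‖F y - F z‖ + s.card * |c y - c z| := by fun_prop
  simpa using this.tendsto z

/-- Extend into the convex set of finitely supported nonnegative vectors. If such a vector is within
`c` of a point `k` of the complex, its coordinates outside the simplex of `k` are at most `c`.
Subtracting `c` and taking positive parts therefore lands in the cone over that simplex, and
normalizing lands in the simplex wherever the result is nonzero. -/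
theorem isANESet_realization (K : PreAbstractSimplicialComplex V) : IsANESet (realization K) := by
  intro Z _ _ A f hA hf hfK
  let _ := TopologicalSpace.metrizableSpaceMetric Z
  rcases A.eq_empty_or_nonempty with rfl | hAne
  · exact ⟨∅, isOpen_empty, le_rfl, f, continuousOn_empty _, mapsTo_empty _ _, eqOn_empty _ _⟩
  let C : Set (lp (fun _ : V => ℝ) 1) :=
    {x | (∀ v, 0 ≤ x v) ∧ ∃ s : Finset V, ∀ v, v ∉ s → x v = 0}
  have hC : Convex ℝ C := by
    classical
    rintro x ⟨hx, s, hs⟩ y ⟨hy, t, ht⟩ a b ha hb -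
    refine ⟨fun v => ?_, s ∪ t, fun v hv => ?_⟩
    · have := hx v
      have := hy v
      simp only [lp.coeFn_add, lp.coeFn_smul, Pi.add_apply, Pi.smul_apply, smul_eq_mul]
      positivity
    · rw [Finset.notMem_union] at hv
      change a * x v + b * y v = 0
      rw [hs v hv.1, ht v hv.2, mul_zero, mul_zero, add_zero]
  have hKC : realization K ⊆ C := fun x ⟨h0, s, _, hs, _⟩ => ⟨h0, s, hs⟩
  obtain ⟨F, hF, hFC, hFf⟩ := exists_continuous_extension_convex hA hf hC
    ⟨0, fun v => by simp, ∅, fun v _ => by simp⟩ (hfK.mono_right hKC)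
  have hKne : (realization K).Nonempty := let ⟨z, hz⟩ := hAne; ⟨f z, hfK hz⟩
  -- The distance to the complex need not be attained. The second summand makes `c` strictly larger
  -- than it off `A`, and vanishes on `A`, so the map is unchanged there.
  let c : Z → ℝ := fun z => Metric.infDist (F z) (realization K) + Metric.infDist z A
  have hc : Continuous c := ((Metric.continuous_infDist_pt _).comp hF).add
    (Metric.continuous_infDist_pt _)
  have hc0 : ∀ z, 0 ≤ c z := fun z => add_nonneg Metric.infDist_nonneg Metric.infDist_nonneg
  have hcA : ∀ z ∈ A, c z = 0 := fun z hz => by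
    have : F z ∈ realization K := by rw [hFf hz]; exact hfK hz
    simp [c, Metric.infDist_zero_of_mem this, Metric.infDist_zero_of_mem hz]
  have hnear : ∀ z, ∃ k ∈ realization K, dist (F z) k ≤ c z := by
    intro z
    by_cases hz : z ∈ A
    · exact ⟨f z, hfK hz, by rw [hFf hz, dist_self]; exact hc0 z⟩
    · have h1 : Metric.infDist (F z) (realization K) < c z :=
        lt_add_of_pos_right _ ((hA.notMem_iff_infDist_pos hAne).1 hz)
      obtain ⟨k, hk, h⟩ := (Metric.infDist_lt_iff hKne).1 h1
      exact ⟨k, hk, h.le⟩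
  let y : Z → lp (fun _ : V => ℝ) 1 := fun z => subPosPart (F z) (c z)
  have hyA : ∀ z ∈ A, y z = f z := fun z hz => by
    ext v
    have h0 := (hfK hz).1 v
    simp only [y, hcA z hz, hFf hz, subPosPart_apply, abs_zero, sub_zero, max_eq_left h0]
  have hy : Continuous y := continuous_subPosPart hF hc fun z => (hFC z).2
  refine ⟨{z | y z ≠ 0}, isOpen_ne_fun hy continuous_const, fun z hz => ?_,
    fun z => ‖y z‖⁻¹ • y z, ?_, ?_, ?_⟩
  · rw [mem_ofPred_eq, hyA z hz, ← norm_ne_zero_iff, norm_eq_one_of_mem_realization (hfK hz)]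
    exact one_ne_zero
  · exact (hy.norm.continuousOn.inv₀ fun z hz => norm_ne_zero_iff.2 hz).smul hy.continuousOn
  · intro z hz
    obtain ⟨k, ⟨hk0, s, hs, hks, hk1⟩, hkF⟩ := hnear z
    have hy0 : ∀ v, 0 ≤ y z v := fun v => le_max_right _ _
    have hys : ∀ v, v ∉ s → y z v = 0 := by
      intro v hv
      have h1 := lp.norm_apply_le_norm one_ne_zero (F z - k) v
      rw [← dist_eq_norm, lp.coeFn_sub, Pi.sub_apply, hks v hv, sub_zero, Real.norm_eq_abs] at h1
      refine max_eq_right ?_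
      linarith [le_abs_self (F z v), le_abs_self (c z)]
    have hne : ‖y z‖ ≠ 0 := norm_ne_zero_iff.2 hz
    refine ⟨fun v => ?_, s, hs, fun v hv => ?_, ?_⟩
    · exact mul_nonneg (inv_nonneg.2 (norm_nonneg _)) (hy0 v)
    · change ‖y z‖⁻¹ * y z v = 0
      rw [hys v hv, mul_zero]
    · change ∑ v ∈ s, ‖y z‖⁻¹ * y z v = 1
      rw [← Finset.mul_sum, ← Finset.sum_congr rfl fun v _ => abs_of_nonneg (hy0 v),
        ← norm_eq_sum_of_forall_notMem hys, inv_mul_cancel₀ hne]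
  · intro z hz
    dsimp only
    rw [hyA z hz, norm_eq_one_of_mem_realization (hfK hz), inv_one, one_smul]

theorem isCompact_realization_of_forall_subset {L : PreAbstractSimplicialComplex V} {W : Finset V}
    (hW : ∀ s ∈ L.faces, s ⊆ W) : IsCompact (realization L) := by
  classical
  have hfin : L.faces.Finite := W.powerset.finite_toSet.subset fun s hs =>
    Finset.mem_coe.2 (Finset.mem_powerset.2 (hW s hs))
  let g : (s : Finset V) → (s → ℝ) → lp (fun _ : V => ℝ) 1 := fun s t =>
    ∑ v : s, t v • lp.single 1 v.1 (1 : ℝ)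
  have hgc : ∀ s, Continuous (g s) := fun s => by fun_prop
  have hg1 : ∀ (s : Finset V) (t : s → ℝ) (v : s), g s t v = t v := fun s t v => by
    simp only [g, lp.coeFn_sum, Finset.sum_apply, lp.coeFn_smul, Pi.smul_apply, smul_eq_mul]
    rw [Finset.sum_eq_single v]
    · simp
    · intro w _ hw
      rw [lp.single_apply_ne _ _ _ fun h => hw (Subtype.ext h.symm), mul_zero]
    · simp
  have hg0 : ∀ (s : Finset V) (t : s → ℝ) (v : V), v ∉ s → g s t v = 0 := fun s t v hv => by
    simp only [g, lp.coeFn_sum, Finset.sum_apply, lp.coeFn_smul, Pi.smul_apply, smul_eq_mul]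
    refine Finset.sum_eq_zero fun w _ => ?_
    rw [lp.single_apply_ne _ _ _ fun h : v = w => hv (h ▸ w.2), mul_zero]
  have : realization L = ⋃ s ∈ L.faces, g s '' stdSimplex ℝ s := by
    ext x
    simp only [mem_iUnion, exists_prop]
    constructor
    · rintro ⟨h0, s, hs, hxs, h1⟩
      refine ⟨s, hs, fun v => x v, ⟨fun v => h0 v, ?_⟩, ?_⟩
      · rw [← h1, ← Finset.sum_coe_sort s fun v => x v]
      · ext v
        by_cases hv : v ∈ s
        · exact hg1 s _ ⟨v, hv⟩
        · rw [hg0 s _ v hv, hxs v hv]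
    · rintro ⟨s, hs, t, ht, rfl⟩
      refine ⟨fun v => ?_, s, hs, hg0 s t, ?_⟩
      · by_cases hv : v ∈ s
        · rw [hg1 s t ⟨v, hv⟩]; exact ht.1 _
        · rw [hg0 s t v hv]
      · rw [← Finset.sum_coe_sort s fun v => g s t v, ← ht.2]
        exact Finset.sum_congr rfl fun v _ => hg1 s t v
  rw [this]
  exact hfin.isCompact_biUnion fun s _ => (isCompact_stdSimplex ℝ s).image (hgc s)

theorem exists_pos_of_mem_realization {K : PreAbstractSimplicialComplex V}
    {x : lp (fun _ : V => ℝ) 1} (hx : x ∈ realization K) : ∃ v, 0 < x v := by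
  obtain ⟨h0, s, -, hs, h1⟩ := hx
  by_contra! h
  rw [Finset.sum_eq_zero fun v _ => le_antisymm (h v) (h0 v)] at h1
  exact zero_ne_one h1

/-- A simplicial complex with locally compact realization is locally finite. -/
theorem finite_setOf_adjacent (K : PreAbstractSimplicialComplex V)
    [LocallyCompactSpace (realization K)] (v : V) :
    {w | ∃ s ∈ K.faces, v ∈ s ∧ w ∈ s}.Finite := by
  classical
  by_contra hinf
  have hpair : ∀ w ∈ {w | ∃ s ∈ K.faces, v ∈ s ∧ w ∈ s}, {v, w} ∈ K.faces := by
    rintro w ⟨s, hs, hv, hw⟩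
    refine (K.isRelLowerSet_faces hs).2 ?_ ⟨v, by simp⟩
    intro x hx
    rcases Finset.mem_insert.1 hx with rfl | hx
    · exact hv
    · rwa [Finset.mem_singleton.1 hx]
  have hv : {v} ∈ K.faces := by
    obtain ⟨w, hw⟩ := (show {w | ∃ s ∈ K.faces, v ∈ s ∧ w ∈ s}.Infinite from hinf).nonempty
    obtain ⟨s, hs, hvs, -⟩ := hw
    exact (K.isRelLowerSet_faces hs).2 (Finset.singleton_subset_iff.2 hvs) ⟨v, by simp⟩
  let e : V → lp (fun _ : V => ℝ) 1 := fun w => lp.single 1 w (1 : ℝ)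
  have hen : ∀ w, ‖e w‖ = 1 := fun w => by simp [e, lp.norm_single]
  have he : ∀ w x, e w x = if x = w then 1 else 0 := fun w x => by
    by_cases h : x = w
    · subst h; simp [e]
    · rw [if_neg h]; exact lp.single_apply_ne _ _ _ h
  -- Points at parameter `ε` on the edges from `v` lie within `2 * ε` of the vertex, yet any two
  -- distinct ones are at least `ε` apart. Infinitely many of them cannot fit in a compact
  -- neighbourhood covered by finitely many balls of radius `ε / 2`.
  let x : ℝ → V → lp (fun _ : V => ℝ) 1 := fun ε w => (1 - ε) • e v + ε • e w
  have hx : ∀ ε w u, x ε w u = (1 - ε) * e v u + ε * e w u := fun ε w u => rfl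
  have hmem : ∀ ε, 0 ≤ ε → ε ≤ 1 → ∀ w, {v, w} ∈ K.faces → x ε w ∈ realization K := by
    intro ε h0 h1 w hw
    refine ⟨fun u => ?_, {v, w}, hw, fun u hu => ?_, ?_⟩
    · have h2 : 0 ≤ 1 - ε := by linarith
      rw [hx, he, he]
      split_ifs <;> positivity
    · rw [Finset.mem_insert, Finset.mem_singleton, not_or] at hu
      rw [hx, he, he, if_neg hu.1, if_neg hu.2]
      ring
    · simp only [hx, he, Finset.sum_add_distrib, ← Finset.mul_sum, Finset.sum_ite_eq']
      simp
  have hev : x 0 v ∈ realization K := hmem 0 le_rfl zero_le_one v (by simpa using hv)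
  obtain ⟨N, hN, hNv⟩ := exists_compact_mem_nhds (⟨x 0 v, hev⟩ : realization K)
  obtain ⟨δ, hδ, hball⟩ := Metric.mem_nhds_iff.1 hNv
  obtain ⟨ε, hε0, hε1, hεδ⟩ : ∃ ε : ℝ, 0 < ε ∧ ε ≤ 1 ∧ 2 * ε < δ :=
    ⟨min 1 (δ / 4), by positivity, min_le_left _ _, by linarith [min_le_right 1 (δ / 4)]⟩
  have hxN : ∀ w (hw : {v, w} ∈ K.faces),
      (⟨x ε w, hmem ε hε0.le hε1 w hw⟩ : realization K) ∈ N := by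
    intro w hw
    refine hball ?_
    rw [Metric.mem_ball, Subtype.dist_eq, dist_eq_norm]
    have : x ε w - x 0 v = ε • (e w - e v) := by
      simp only [x, sub_smul, one_smul, zero_smul, smul_sub]; abel
    rw [this, norm_smul, Real.norm_of_nonneg hε0.le]
    have := norm_sub_le (e w) (e v)
    rw [hen, hen] at this
    nlinarith
  obtain ⟨t, -, ht, hcov⟩ := hN.finite_cover_balls (half_pos hε0)
  have hcov' : ∀ w : {w | ∃ s ∈ K.faces, v ∈ s ∧ w ∈ s}, ∃ y ∈ t,
      dist (x ε w) (y : lp (fun _ : V => ℝ) 1) < ε / 2 := fun w => by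
    simpa [Subtype.dist_eq] using hcov (hxN w.1 (hpair _ w.2))
  choose c hct hc using hcov'
  have : Infinite {w | ∃ s ∈ K.faces, v ∈ s ∧ w ∈ s} := infinite_coe_iff.2 hinf
  have : Finite t := ht
  obtain ⟨w₁, w₂, hne, heq⟩ := Finite.exists_ne_map_eq_of_infinite
    fun w => (⟨c w, hct w⟩ : t)
  have hlt : dist (x ε w₁) (x ε w₂) < ε := by
    have h1 := hc w₁
    have h2 := hc w₂
    rw [← show c w₁ = c w₂ from congrArg Subtype.val heq] at h2
    linarith [dist_triangle_right (x ε w₁) (x ε w₂) (c w₁ : lp (fun _ : V => ℝ) 1)]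
  have key : ∀ w w' : V, w ≠ w' → w ≠ v → ε ≤ dist (x ε w) (x ε w') := by
    intro w w' h1 h2
    have h3 := lp.norm_apply_le_norm one_ne_zero (x ε w - x ε w') w
    rw [← dist_eq_norm, lp.coeFn_sub, Pi.sub_apply, hx, hx, he, he, he, if_neg h2, if_pos rfl,
      if_neg h1, Real.norm_eq_abs] at h3
    refine le_trans ?_ h3
    rw [show (1 - ε) * 0 + ε * 1 - ((1 - ε) * 0 + ε * 0) = ε by ring]
    exact le_abs_self ε
  have hne' : w₁.1 ≠ w₂.1 := fun h => hne (Subtype.ext h)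
  by_cases h : w₁.1 = v
  · have := key w₂ w₁ hne'.symm fun h' => hne' (h.trans h'.symm)
    rw [dist_comm] at this
    linarith
  · linarith [key w₁ w₂ hne' h]

variable {P : Type u} [TopologicalSpace P]

theorem IsPolyhedron.exists_isEmbedding (hP : IsPolyhedron P) :
    ∃ (V : Type u) (κ : P → lp (fun _ : V => ℝ) 1), IsEmbedding κ ∧ ∀ a, ‖κ a‖ = 1 := by
  obtain ⟨V, K, ⟨h⟩⟩ := hP
  exact ⟨V, fun a => h a, IsEmbedding.subtypeVal.comp h.isEmbedding,
    fun a => norm_eq_one_of_mem_realization (h a).2⟩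

theorem IsPolyhedron.metrizableSpace (hP : IsPolyhedron P) :
    TopologicalSpace.MetrizableSpace P := by
  obtain ⟨V, κ, hκ, -⟩ := hP.exists_isEmbedding
  exact hκ.metrizableSpace

theorem IsPolyhedron.isANESet_univ (hP : IsPolyhedron P) : IsANESet (univ : Set P) := by
  obtain ⟨V, K, ⟨h⟩⟩ := hP
  have hi : IsEmbedding fun a => (h a : lp (fun _ : V => ℝ) 1) :=
    IsEmbedding.subtypeVal.comp h.isEmbedding
  convert (isANESet_realization K).preimage_of_isEmbedding hi
    fun x hx => ⟨h.symm ⟨x, hx⟩, by simp⟩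
  ext a
  simp

/-- In a locally compact polyhedron, every compact set lies in the interior of a compact absolute
neighbourhood extensor, namely a finite subcomplex. -/
theorem IsPolyhedron.exists_isCompact_isANESet [LocallyCompactSpace P] (hP : IsPolyhedron P)
    {C : Set P} (hC : IsCompact C) :
    ∃ Q : Set P, IsCompact Q ∧ IsANESet Q ∧ C ⊆ interior Q := by
  classical
  obtain ⟨V, K, ⟨h⟩⟩ := hP
  have : LocallyCompactSpace (realization K) := h.symm.isOpenEmbedding.locallyCompactSpace
  let i : P → lp (fun _ : V => ℝ) 1 := fun a => h a
  have hi : IsEmbedding i := IsEmbedding.subtypeVal.comp h.isEmbedding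
  let O : V → Set P := fun v => {a | 0 < i a v}
  have hO : ∀ v, IsOpen (O v) := fun v =>
    isOpen_lt continuous_const
      (((lp.lipschitzWith_one_eval 1 v).continuous).comp hi.continuous)
  obtain ⟨t, ht⟩ := hC.elim_finite_subcover O hO fun a _ =>
    mem_iUnion.2 (exists_pos_of_mem_realization (h a).2)
  -- The open stars of the vertices in `t` cover `C`. Adding the finitely many vertices adjacent to
  -- `t` makes the full subcomplex `L` on `W` contain these stars, so `C` lies in its interior.
  let W : Finset V := t.biUnion fun v => (finite_setOf_adjacent K v).toFinset
  let L : PreAbstractSimplicialComplex V :=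
    { faces := {s | s ∈ K.faces ∧ s ⊆ W}
      isRelLowerSet_faces := fun {s} hs => ⟨(K.isRelLowerSet_faces hs.1).1, fun r hr hr' =>
        ⟨(K.isRelLowerSet_faces hs.1).2 hr hr', (show r ⊆ s from hr).trans hs.2⟩⟩ }
  have hLK : realization L ⊆ range i := by
    rintro x ⟨h0, s, hs, hx⟩
    exact ⟨h.symm ⟨x, h0, s, hs.1, hx⟩, by simp [i]⟩
  refine ⟨i ⁻¹' realization L, (hi.isInducing.isCompact_preimage_iff hLK).2
    (isCompact_realization_of_forall_subset fun s hs => hs.2),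
    (isANESet_realization L).preimage_of_isEmbedding hi hLK, fun a ha => ?_⟩
  obtain ⟨v, hv, hav⟩ := mem_iUnion₂.1 (ht ha)
  refine mem_interior.2 ⟨O v, fun b hb => ?_, hO v, hav⟩
  obtain ⟨h0, s, hs, hbs, h1⟩ := (h b).2
  refine ⟨h0, s, ⟨hs, fun w hw => ?_⟩, hbs, h1⟩
  have hvs : v ∈ s := by
    by_contra hvs
    exact (ne_of_gt (show 0 < i b v from hb)) (hbs v hvs)
  exact Finset.mem_biUnion.2 ⟨v, hv, by simpa using ⟨s, hs, hvs, hw⟩⟩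

end Realization

/-! ### Lowering heights in a mapping cylinder -/

namespace MapCyl

variable {A B : Type u} [TopologicalSpace A] [TopologicalSpace B] (f : C(A, B))

/-- Lower the height of a point of the mapping cylinder to at most `σ`, where `b` is the projection
to be used for the resulting point. -/
noncomputable def lower (b : B) (σ : ℝ) : MapCyl f → MapCyl f
  | body a s => mk f b a (min s σ)
  | base _ => base b

theorem lower_of_one_le {σ : ℝ} (hσ : 1 ≤ σ) (z : MapCyl f) : lower f (proj f z) σ z = z := by
  cases z with
  | body a s =>
    have : min (s : ℝ) σ = s := min_eq_left (s.2.2.trans hσ)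
    rw [lower, this]
    exact mk_of_mem f s.2
  | base b => rfl

theorem proj_lower {b : B} {σ : ℝ} {z : MapCyl f} (h : 0 < σ → proj f z = b) :
    proj f (lower f b σ z) = b := by
  cases z with
  | body a s => exact proj_mk f fun hs => h (lt_min_iff.1 hs).2
  | base b => rfl

theorem height_lower {b : B} {σ : ℝ} (hσ : 0 ≤ σ) (z : MapCyl f) :
    height f (lower f b σ z) = min (height f z) σ := by
  cases z with
  | body a s => exact height_mk f (le_min s.2.1.le hσ) ((min_le_left _ _).trans s.2.2)
  | base b => exact (min_eq_left hσ).symm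

/-- Where `σ = 0` the result is the base point `b z`, which need not be the projection of `g z`;
compatibility is required only while some height remains. -/
theorem continuous_lower {Z : Type*} [TopologicalSpace Z] {b : Z → B} {σ : Z → ℝ}
    {g : Z → MapCyl f} (hb : Continuous b) (hσ : Continuous σ) (hσ0 : ∀ z, 0 ≤ σ z)
    (hg : Continuous g) (h : ∀ z, 0 < σ z → proj f (g z) = b z) :
    Continuous fun z => lower f (b z) (σ z) (g z) := by
  rcases isEmpty_or_nonempty A with hA | hA
  · refine ((continuous_base f).comp hb).congr fun z => ?_
    rw [eq_base_of_isEmpty f (g z)]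
    rfl
  · have key : ∀ z, lower f (b z) (σ z) (g z) =
        mk f (b z) (comp f (g z)) (min (height f (g z)) (σ z)) := by
      intro z
      cases g z with
      | body a s => rfl
      | base b => exact (mk_of_nonpos f (min_le_left _ _)).symm
    simp only [key]
    have hh : Continuous fun z => height f (g z) := (continuous_height f).comp hg
    rw [← continuousOn_univ]
    refine continuousOn_mk f hb.continuousOn (hh.min hσ).continuousOn
      (fun z _ => le_min (height_nonneg f _) (hσ0 z))
      (fun z _ => (min_le_left _ _).trans (height_le_one f _)) ?_ fun z _ hz => ?_
    · exact (continuousOn_comp f).comp hg.continuousOn fun z hz =>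
        (lt_min_iff.1 (show 0 < min (height f (g z)) (σ z) from hz.2)).1
    · rw [← h z (lt_min_iff.1 hz).2, map_comp f (lt_min_iff.1 hz).1]

theorem isEmbedding_top : IsEmbedding (top f) :=
  (isOpenEmbedding_body f).isEmbedding.comp (isEmbedding_prodMkLeft _)

end MapCyl

/-! ### Finite telescopes and their subsets under graphs -/

section Telescope

open MapCyl

variable {P : ℕ → Type u} [∀ i, TopologicalSpace (P i)] (p : ∀ i, C(P (i + 1), P i))

/-- The map whose mapping cylinder is `P_[0,n+1]`. -/
abbrev attachingMap (n : ℕ) : C(P (n + 1), FiniteTelescope p n) := (lastLevel p n).comp (p n)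

theorem isEmbedding_lastLevel : ∀ n, IsEmbedding (lastLevel p n)
  | 0 => IsEmbedding.id
  | n + 1 => isEmbedding_top (attachingMap p n)

theorem finiteTelescope_metrizableSpace (hP : ∀ n, IsPolyhedron (P n)) :
    ∀ n, TopologicalSpace.MetrizableSpace (FiniteTelescope p n)
  | 0 => (hP 0).metrizableSpace
  | n + 1 => by
    obtain ⟨V, κ, hκ, hκ1⟩ := (hP (n + 1)).exists_isEmbedding
    have := finiteTelescope_metrizableSpace hP n
    exact MapCyl.metrizableSpace (attachingMap p n) hκ hκ1

/-- The height function on the last mapping cylinder of `P_[0,n+1]`. -/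
def lastHeight (n : ℕ) : FiniteTelescope p (n + 1) → ℝ := height (attachingMap p n)

theorem continuous_lastHeight (n : ℕ) : Continuous (lastHeight p n) :=
  continuous_height (attachingMap p n)

theorem exists_lastLevel_of_lastHeight_eq_one {n : ℕ} {z : FiniteTelescope p (n + 1)}
    (hz : lastHeight p n z = 1) : ∃ a, lastLevel p (n + 1) a = z := by
  change MapCyl (attachingMap p n) at z
  cases z with
  | body a s => exact ⟨a, congrArg (body a) (Subtype.ext hz.symm)⟩
  | base b => exact (zero_ne_one hz).elim

/-- The inclusion `P_[0,n] → P_[0,n+1]`. -/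
def telescopeBase (n : ℕ) : C(FiniteTelescope p n, FiniteTelescope p (n + 1)) :=
  ⟨base (f := attachingMap p n), continuous_base _⟩

theorem telescopeRetr_base (n : ℕ) (z : FiniteTelescope p n) :
    telescopeRetr p n (telescopeBase p n z) = z := rfl

theorem lastHeight_base (n : ℕ) (z : FiniteTelescope p n) :
    lastHeight p n (telescopeBase p n z) = 0 := rfl

theorem telescopeBase_retr {n : ℕ} {z : FiniteTelescope p (n + 1)} (hz : lastHeight p n z = 0) :
    telescopeBase p n (telescopeRetr p n z) = z := by
  change MapCyl (attachingMap p n) at z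
  cases z with
  | body a s => exact (s.2.1.ne' hz).elim
  | base b => rfl

/-- The subset of `P_[0,n]` lying over `Q ⊆ P 0` and under the graphs of the functions `φ n` on
`P (n + 1)`. -/
def subTelescope (Q : Set (P 0)) (φ : ∀ n, P (n + 1) → ℝ) : ∀ n, Set (FiniteTelescope p n)
  | 0 => Q
  | n + 1 => {z : MapCyl (attachingMap p n) | proj (attachingMap p n) z ∈ subTelescope Q φ n ∧
      ∀ a s, z = body a s → s ≤ φ n a}

/-- The conditions under which the sets `subTelescope p Q φ n` are closed under the structure maps:
each mapping cylinder is attached to the part of the previous top of full height. -/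
structure IsAdmissible (Q : Set (P 0)) (φ : ∀ n, P (n + 1) → ℝ) : Prop where
  continuous : ∀ n, Continuous (φ n)
  zero : ∀ a, 0 < φ 0 a → p 0 a ∈ Q
  succ : ∀ n a, 0 < φ (n + 1) a → 1 ≤ φ n (p (n + 1) a)

variable {p} {Q : Set (P 0)} {φ : ∀ n, P (n + 1) → ℝ}

theorem mem_subTelescope_succ {n : ℕ} {z : FiniteTelescope p (n + 1)} :
    z ∈ subTelescope p Q φ (n + 1) ↔ telescopeRetr p n z ∈ subTelescope p Q φ n ∧
      ∀ a s, z = body (f := attachingMap p n) a s → s ≤ φ n a := Iff.rfl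

theorem telescopeBase_mem_subTelescope {n : ℕ} {z : FiniteTelescope p n}
    (hz : z ∈ subTelescope p Q φ n) : telescopeBase p n z ∈ subTelescope p Q φ (n + 1) :=
  ⟨hz, fun a s h => by cases h⟩

/-- The base points over which cylinder `n + 1` has positive height are top points of cylinder `n`,
which belong to the subset exactly when the allowed height there is at least `1`. -/
theorem IsAdmissible.lastLevel_mem (h : IsAdmissible p Q φ) :
    ∀ n a, 0 < φ n a → lastLevel p n (p n a) ∈ subTelescope p Q φ n
  | 0, a, ha => h.zero a ha
  | n + 1, a, ha => by
    have h1 := h.succ n a ha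
    refine ⟨h.lastLevel_mem n _ (zero_lt_one.trans_le h1), fun a' s h' => ?_⟩
    cases h'
    exact h1

theorem IsAdmissible.isANESet (h : IsAdmissible p Q φ)
    (hT : ∀ n, TopologicalSpace.MetrizableSpace (FiniteTelescope p n)) (hQ : IsANESet Q)
    (hP : ∀ n, IsANESet (univ : Set (P n))) : ∀ n, IsANESet (subTelescope p Q φ n)
  | 0 => hQ
  | n + 1 => by
    have hA : IsANESet {a | 0 < φ n a} := by
      simpa using (hP (n + 1)).inter_isOpen (isOpen_lt continuous_const (h.continuous n))
    exact isANESet_setOf_le (attachingMap p n) (h.isANESet hT hQ hP n) (h.continuous n) hA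
      (h.lastLevel_mem n)

theorem IsAdmissible.isCompact (h : IsAdmissible p Q φ)
    (hT : ∀ n, TopologicalSpace.MetrizableSpace (FiniteTelescope p n)) (hQ : IsCompact Q)
    (hφ : ∀ n, ∀ δ > 0, IsCompact {a | δ ≤ φ n a}) : ∀ n, IsCompact (subTelescope p Q φ n)
  | 0 => hQ
  | n + 1 => isCompact_setOf_le (attachingMap p n) (h.isCompact hT hQ hφ n) (h.continuous n) (hφ n)

/-! ### The deformation of the extended telescope into finite telescopes -/

/-- The maximal height in the `n`-th mapping cylinder at time `s` of the deformation. -/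
noncomputable def cutHeight (n : ℕ) (s : ℝ) : ℝ := max (2 - 2 ^ (n + 1) * s) 0

theorem continuous_cutHeight (n : ℕ) : Continuous (cutHeight n) := by
  unfold cutHeight; fun_prop

theorem cutHeight_nonneg (n : ℕ) (s : ℝ) : 0 ≤ cutHeight n s := le_max_right _ _

/-- The cut of cylinder `n` falls from `1` to `0` while `s` runs from `(1 / 2) ^ (n + 1)` to `(1 /
2) ^ n`. These time intervals overlap only at endpoints, so a cylinder is gone before the one below
it is touched. -/
theorem one_le_cutHeight {n : ℕ} {s : ℝ} (h : s ≤ (1 / 2) ^ (n + 1)) : 1 ≤ cutHeight n s := by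
  refine le_max_of_le_left ?_
  have : (2 : ℝ) ^ (n + 1) * s ≤ 2 ^ (n + 1) * (1 / 2) ^ (n + 1) := by gcongr
  rw [← mul_pow] at this
  norm_num at this
  linarith

theorem cutHeight_eq_zero {n : ℕ} {s : ℝ} (h : (1 / 2) ^ n ≤ s) : cutHeight n s = 0 := by
  refine max_eq_right ?_
  have : (2 : ℝ) ^ n * (1 / 2) ^ n ≤ 2 ^ n * s := by gcongr
  rw [← mul_pow] at this
  norm_num at this
  rw [pow_succ]
  linarith

theorem le_of_cutHeight_pos {n : ℕ} {s : ℝ} (h : 0 < cutHeight n s) : s ≤ (1 / 2) ^ n := by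
  by_contra! h'
  rw [cutHeight_eq_zero h'.le] at h
  exact lt_irrefl _ h

variable (p) in
/-- The deformation of `P_[0,n]` that cuts the `m`-th mapping cylinder at height `cutHeight m s`. -/
noncomputable def cut : ∀ n, ℝ → FiniteTelescope p n → FiniteTelescope p n
  | 0, _, z => z
  | n + 1, s, z => lower (attachingMap p n) (cut n s (telescopeRetr p n z)) (cutHeight n s) z

theorem cut_eq_self : ∀ {n : ℕ} {s : ℝ}, s ≤ (1 / 2) ^ n → ∀ z, cut p n s z = z
  | 0, _, _, _ => rfl
  | n + 1, s, hs, z => by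
    have hs' : s ≤ (1 / 2) ^ n := hs.trans (pow_le_pow_of_le_one (by norm_num) (by norm_num)
      (Nat.le_succ n))
    rw [cut, cut_eq_self hs']
    exact lower_of_one_le _ (one_le_cutHeight hs) z

/-- While cylinder `n` keeps positive height, the deformation is still the identity on the telescope
below, so lowering does not disturb projections. This compatibility lets the cuts pass to the
inverse limit. -/
theorem telescopeRetr_cut (n : ℕ) (s : ℝ) (z : FiniteTelescope p (n + 1)) :
    telescopeRetr p n (cut p (n + 1) s z) = cut p n s (telescopeRetr p n z) :=
  proj_lower _ fun h => (cut_eq_self (le_of_cutHeight_pos h) _).symm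

theorem lastHeight_cut (n : ℕ) (s : ℝ) (z : FiniteTelescope p (n + 1)) :
    lastHeight p n (cut p (n + 1) s z) = min (lastHeight p n z) (cutHeight n s) :=
  height_lower _ (cutHeight_nonneg n s) z

theorem continuous_cut : ∀ n, Continuous fun q : ℝ × FiniteTelescope p n => cut p n q.1 q.2
  | 0 => continuous_snd
  | n + 1 => continuous_lower (attachingMap p n)
      (Z := ℝ × FiniteTelescope p (n + 1)) (b := fun q => cut p n q.1 (telescopeRetr p n q.2))
      (σ := fun q => cutHeight n q.1) (g := fun q => q.2)
      ((continuous_cut n).comp (continuous_fst.prodMk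
        ((telescopeRetr p n).continuous.comp continuous_snd)))
      ((continuous_cutHeight n).comp continuous_fst) (fun _ => cutHeight_nonneg n _) continuous_snd
      fun _ h => (cut_eq_self (le_of_cutHeight_pos h) _).symm

theorem cut_mem_subTelescope : ∀ {n : ℕ} {s : ℝ} {z : FiniteTelescope p n},
    z ∈ subTelescope p Q φ n → cut p n s z ∈ subTelescope p Q φ n
  | 0, _, _, hz => hz
  | n + 1, s, z, hz => by
    refine mem_subTelescope_succ.2 ⟨?_, fun a t h => ?_⟩
    · rw [telescopeRetr_cut]
      exact cut_mem_subTelescope hz.1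
    · have h1 := lastHeight_cut n s z
      rw [h] at h1
      have h2 : (t : ℝ) ≤ lastHeight p n z := h1.trans_le (min_le_left _ _)
      change MapCyl (attachingMap p n) at z
      cases z with
      | base b => exact absurd h2 (not_le.2 t.2.1)
      | body a' t' =>
        -- Lowering changes only the height of a point that stays off the base, so the same value of
        -- `φ n` bounds it.
        have h3 : a = a' := by
          change mk (attachingMap p n) _ a' _ = _ at h
          unfold MapCyl.mk at h
          split_ifs at h
          cases h
          rfl
        subst h3
        exact h2.trans (hz.2 a t' rfl)

variable (p) in
/-- The deformation of the extended telescope. -/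
noncomputable def cutExtended (q : ℝ × ExtendedTelescope p) : ExtendedTelescope p :=
  ⟨fun n => cut p n q.1 (q.2.1 n), fun n => by rw [telescopeRetr_cut, q.2.2 n]⟩

theorem continuous_coordinate (n : ℕ) : Continuous fun y : ExtendedTelescope p => y.1 n :=
  (continuous_apply n).comp continuous_subtype_val

theorem continuous_extendedTelescope {Z : Type*} [TopologicalSpace Z] {g : Z → ExtendedTelescope p}
    (hg : ∀ n, Continuous fun z => (g z).1 n) : Continuous g :=
  Continuous.subtype_mk (continuous_pi hg) _

theorem continuous_cutExtended : Continuous (cutExtended p) :=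
  continuous_extendedTelescope fun n =>
    (continuous_cut n).comp (continuous_fst.prodMk ((continuous_coordinate n).comp continuous_snd))

theorem cutExtended_zero (y : ExtendedTelescope p) : cutExtended p (0, y) = y :=
  Subtype.ext (funext fun _ => cut_eq_self (by positivity) _)

theorem lastHeight_cutExtended {n : ℕ} {s : ℝ} (hs : (1 / 2) ^ n ≤ s)
    (y : ExtendedTelescope p) (m : ℕ) (hm : n ≤ m) :
    lastHeight p m ((cutExtended p (s, y)).1 (m + 1)) = 0 := by
  have h1 : lastHeight p m (cut p (m + 1) s (y.1 (m + 1))) = _ := lastHeight_cut m s _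
  have h2 : (1 / 2 : ℝ) ^ m ≤ s :=
    (pow_le_pow_of_le_one (by norm_num) (by norm_num) hm).trans hs
  rw [cutHeight_eq_zero h2] at h1
  exact h1.trans (min_eq_right (height_nonneg (attachingMap p m) _))

/-! ### The finite telescopes as subsets of the extended telescope -/

variable (p) in
/-- The composite retraction `P_[0,n] → P_[0,m]` for `m ≤ n`. -/
def retrLE {m n : ℕ} (h : m ≤ n) : C(FiniteTelescope p n, FiniteTelescope p m) :=
  Nat.leRecOn (C := fun k => C(FiniteTelescope p k, FiniteTelescope p m)) h
    (fun {k} g => g.comp (telescopeRetr p k)) (ContinuousMap.id _)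

variable (p) in
/-- The composite inclusion `P_[0,n] → P_[0,m]` for `n ≤ m`. -/
def baseLE {n m : ℕ} (h : n ≤ m) : C(FiniteTelescope p n, FiniteTelescope p m) :=
  Nat.leRecOn (C := fun k => C(FiniteTelescope p n, FiniteTelescope p k)) h
    (fun {k} g => (telescopeBase p k).comp g) (ContinuousMap.id _)

theorem retrLE_self (n : ℕ) : retrLE p (le_refl n) = ContinuousMap.id _ := Nat.leRecOn_self _

theorem retrLE_succ {m n : ℕ} (h : m ≤ n) (z : FiniteTelescope p (n + 1)) :
    retrLE p (h.trans n.le_succ) z = retrLE p h (telescopeRetr p n z) := by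
  rw [retrLE, Nat.leRecOn_succ h]
  rfl

theorem baseLE_self (n : ℕ) : baseLE p (le_refl n) = ContinuousMap.id _ := Nat.leRecOn_self _

theorem baseLE_succ {n m : ℕ} (h : n ≤ m) (z : FiniteTelescope p n) :
    baseLE p (h.trans m.le_succ) z = telescopeBase p m (baseLE p h z) := by
  rw [baseLE, Nat.leRecOn_succ h]
  rfl

theorem telescopeRetr_retrLE {m n : ℕ} (h : m + 1 ≤ n) (z : FiniteTelescope p n) :
    telescopeRetr p m (retrLE p h z) = retrLE p (m.le_succ.trans h) z := by
  induction n, h using Nat.le_induction with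
  | base => rw [retrLE_self, retrLE_succ le_rfl, retrLE_self]; rfl
  | succ n h ih => rw [retrLE_succ h, ih, retrLE_succ (m.le_succ.trans h)]

theorem retrLE_coordinate (y : ExtendedTelescope p) {m n : ℕ} (h : m ≤ n) :
    retrLE p h (y.1 n) = y.1 m := by
  induction n, h using Nat.le_induction with
  | base => rw [retrLE_self]; rfl
  | succ n h ih => rw [retrLE_succ h, y.2 n, ih]

theorem baseLE_coordinate {y : ExtendedTelescope p} {n m : ℕ} (h : n ≤ m)
    (hy : ∀ k, n ≤ k → lastHeight p k (y.1 (k + 1)) = 0) : baseLE p h (y.1 n) = y.1 m := by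
  induction m, h using Nat.le_induction with
  | base => rw [baseLE_self]; rfl
  | succ m h ih => rw [baseLE_succ h, ih, ← y.2 m, telescopeBase_retr p (hy m h)]

theorem retrLE_mem {m n : ℕ} (h : m ≤ n) {z : FiniteTelescope p n}
    (hz : z ∈ subTelescope p Q φ n) : retrLE p h z ∈ subTelescope p Q φ m := by
  induction n, h using Nat.le_induction with
  | base => rw [retrLE_self]; exact hz
  | succ n h ih => rw [retrLE_succ h]; exact ih hz.1

theorem baseLE_mem {n m : ℕ} (h : n ≤ m) {z : FiniteTelescope p n}
    (hz : z ∈ subTelescope p Q φ n) : baseLE p h z ∈ subTelescope p Q φ m := by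
  induction m, h using Nat.le_induction with
  | base => rw [baseLE_self]; exact hz
  | succ m h ih => rw [baseLE_succ h]; exact telescopeBase_mem_subTelescope ih

variable (p) in
/-- The inclusion of `P_[0,n]` in the extended telescope. -/
def finiteInclusion (n : ℕ) (z : FiniteTelescope p n) : ExtendedTelescope p :=
  ⟨fun m => if h : m ≤ n then retrLE p h z else baseLE p (le_of_not_ge h) z, fun m => by
    dsimp only
    rcases lt_trichotomy m n with h | rfl | h
    · rw [dif_pos h.le, dif_pos (Nat.succ_le_of_lt h), telescopeRetr_retrLE]
    · rw [dif_pos le_rfl, dif_neg (Nat.not_succ_le_self m), baseLE_succ le_rfl, telescopeRetr_base,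
        baseLE_self, retrLE_self]
    · rw [dif_neg h.not_ge, dif_neg (h.trans m.lt_succ_self).not_ge, baseLE_succ h.le,
        telescopeRetr_base]⟩

theorem finiteInclusion_of_le {n m : ℕ} (h : m ≤ n) (z : FiniteTelescope p n) :
    (finiteInclusion p n z).1 m = retrLE p h z := dif_pos h

theorem finiteInclusion_of_ge {n m : ℕ} (h : n ≤ m) (z : FiniteTelescope p n) :
    (finiteInclusion p n z).1 m = baseLE p h z := by
  rcases h.eq_or_lt with rfl | h
  · rw [finiteInclusion_of_le le_rfl, retrLE_self, baseLE_self]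
  · exact dif_neg h.not_ge

theorem continuous_finiteInclusion (n : ℕ) : Continuous (finiteInclusion p n) :=
  continuous_extendedTelescope fun m => by
    rcases le_total m n with h | h
    · simp only [finiteInclusion_of_le h]
      exact (retrLE p h).continuous
    · simp only [finiteInclusion_of_ge h]
      exact (baseLE p h).continuous

variable (p) in
/-- The subset of the extended telescope whose projections lie in the sets `subTelescope p Q φ n`. -/
def subExtended (Q : Set (P 0)) (φ : ∀ n, P (n + 1) → ℝ) : Set (ExtendedTelescope p) :=
  {y | ∀ n, y.1 n ∈ subTelescope p Q φ n}

theorem cutExtended_mem {s : ℝ} {y : ExtendedTelescope p} (hy : y ∈ subExtended p Q φ) :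
    cutExtended p (s, y) ∈ subExtended p Q φ := fun n => cut_mem_subTelescope (hy n)

theorem extendedTelescope_metrizableSpace
    (hT : ∀ n, TopologicalSpace.MetrizableSpace (FiniteTelescope p n)) :
    TopologicalSpace.MetrizableSpace (ExtendedTelescope p) := by
  let _ := fun n => TopologicalSpace.metrizableSpaceMetric (FiniteTelescope p n)
  have : TopologicalSpace.MetrizableSpace (∀ n, FiniteTelescope p n) :=
    UniformSpace.metrizableSpace
  exact (IsEmbedding.subtypeVal (p := fun x : ∀ n, FiniteTelescope p n =>
    ∀ i, telescopeRetr p i (x (i + 1)) = x i)).metrizableSpace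

/-- The points with height zero from stage `n` on form a copy of `subTelescope p Q φ n`, with
mutually inverse maps given by the `n`-th coordinate and `finiteInclusion`. The cutting homotopy
enters this copy at time `(1 / 2) ^ n`. -/
theorem IsAdmissible.isANESet_subExtended (h : IsAdmissible p Q φ)
    (hT : ∀ n, TopologicalSpace.MetrizableSpace (FiniteTelescope p n)) (hQ : IsANESet Q)
    (hP : ∀ n, IsANESet (univ : Set (P n))) : IsANESet (subExtended p Q φ) := by
  have := extendedTelescope_metrizableSpace hT
  refine IsANESet.of_homotopy (H := cutExtended p) (S := fun n => {y | y ∈ subExtended p Q φ ∧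
    ∀ m, n ≤ m → lastHeight p m (y.1 (m + 1)) = 0}) continuous_cutExtended cutExtended_zero
    (fun n => ?_) (fun n y hy => ⟨hy.1, fun m hm => hy.2 m (n.le_succ.trans hm)⟩)
    (fun n y hy => hy.1)
    fun n s hs y hy => ⟨cutExtended_mem hy, lastHeight_cutExtended hs y⟩
  refine (h.isANESet hT hQ hP n).of_retract (fun y => y.1 n) (finiteInclusion p n)
    (continuous_coordinate n).continuousOn (continuous_finiteInclusion n).continuousOn
    (fun y hy => hy.1 n) (fun z hz => ⟨fun m => ?_, fun m hm => ?_⟩) fun y hy => ?_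
  · rcases le_total m n with hm | hm
    · rw [finiteInclusion_of_le hm]; exact retrLE_mem hm hz
    · rw [finiteInclusion_of_ge hm]; exact baseLE_mem hm hz
  · rw [finiteInclusion_of_ge (hm.trans m.le_succ), baseLE_succ hm, lastHeight_base]
  · refine Subtype.ext (funext fun m => ?_)
    rcases le_total m n with hm | hm
    · rw [finiteInclusion_of_le hm, retrLE_coordinate]
    · rw [finiteInclusion_of_ge hm, baseLE_coordinate hm hy.2]

/-! ### The limit as a Z-set -/

theorem mem_range_limitInclusion_iff {y : ExtendedTelescope p} :
    y ∈ range (limitInclusion p) ↔ ∀ n, lastHeight p n (y.1 (n + 1)) = 1 := by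
  constructor
  · rintro ⟨x, rfl⟩ n
    rfl
  · intro hy
    have hex : ∀ n, ∃ a, lastLevel p n a = y.1 n
      | 0 => ⟨y.1 0, rfl⟩
      | n + 1 => exists_lastLevel_of_lastHeight_eq_one p (hy n)
    choose x hx using hex
    refine ⟨⟨x, fun n => (isEmbedding_lastLevel p n).injective ?_⟩,
      Subtype.ext (funext fun n => hx n)⟩
    rw [← telescopeRetr_lastLevel, hx, hx, y.2 n]

variable (p) in
theorem isClosedEmbedding_limitInclusion : IsClosedEmbedding (limitInclusion p) := by
  have hval : IsEmbedding fun y : ExtendedTelescope p => y.1 := IsEmbedding.subtypeVal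
  have hval' : IsEmbedding fun x : InverseLimit p => x.1 := IsEmbedding.subtypeVal
  have hcomp : IsEmbedding ((fun y : ExtendedTelescope p => y.1) ∘ limitInclusion p) :=
    (IsEmbedding.piMap (isEmbedding_lastLevel p)).comp hval'
  refine ⟨.of_comp ?_ hval.continuous hcomp, ?_⟩
  · exact continuous_extendedTelescope fun n =>
      (lastLevel p n).continuous.comp ((continuous_apply n).comp hval'.continuous)
  · have : range (limitInclusion p) = ⋂ n, {y | lastHeight p n (y.1 (n + 1)) = 1} := by
      ext y
      rw [mem_range_limitInclusion_iff, mem_iInter]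
      rfl
    rw [this]
    exact isClosed_iInter fun n => isClosed_eq
      ((continuous_lastHeight p n).comp (continuous_coordinate (n + 1))) continuous_const

/-- At a positive time some cylinder has been collapsed to height `0`, whereas points of the limit
have height `1` everywhere. -/
theorem cutExtended_notMem_range {s : ℝ} (hs : 0 < s) (y : ExtendedTelescope p) :
    cutExtended p (s, y) ∉ range (limitInclusion p) := by
  obtain ⟨n, hn⟩ := exists_pow_lt_of_lt_one hs (show (1 / 2 : ℝ) < 1 by norm_num)
  intro h
  have h1 := mem_range_limitInclusion_iff.1 h n
  rw [lastHeight_cutExtended hn.le y n le_rfl] at h1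
  exact zero_ne_one h1

variable (p) in
theorem isZSet_range_limitInclusion : IsZSet (range (limitInclusion p)) :=
  ⟨(isClosedEmbedding_limitInclusion p).isClosed_range,
    ⟨fun q => cutExtended p (q.1, q.2), continuous_cutExtended.comp (by fun_prop)⟩,
    fun x => cutExtended_zero x, fun t ht x => cutExtended_notMem_range ht x⟩

theorem isZSet_preimage_range_limitInclusion :
    IsZSet ((Subtype.val : subExtended p Q φ → ExtendedTelescope p) ⁻¹'
      range (limitInclusion p)) :=
  ⟨(isClosedEmbedding_limitInclusion p).isClosed_range.preimage continuous_subtype_val,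
    ⟨fun q => ⟨cutExtended p (q.1, q.2.1), cutExtended_mem q.2.2⟩,
      (continuous_cutExtended.comp (by fun_prop)).subtype_mk _⟩,
    fun x => Subtype.ext (cutExtended_zero x.1), fun t ht x => cutExtended_notMem_range ht x.1⟩

theorem IsAdmissible.isCompact_subExtended (h : IsAdmissible p Q φ)
    (hT : ∀ n, TopologicalSpace.MetrizableSpace (FiniteTelescope p n)) (hQ : IsCompact Q)
    (hφ : ∀ n, ∀ δ > 0, IsCompact {a | δ ≤ φ n a}) : IsCompact (subExtended p Q φ) := by
  have hval : IsClosedEmbedding fun y : ExtendedTelescope p => y.1 := by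
    have : IsClosed {x : ∀ n, FiniteTelescope p n |
        ∀ i, telescopeRetr p i (x (i + 1)) = x i} := by
      simp only [ofPred_forall]
      exact isClosed_iInter fun i => isClosed_eq
        ((telescopeRetr p i).continuous.comp (continuous_apply (i + 1))) (continuous_apply i)
    exact this.isClosedEmbedding_subtypeVal
  have := hval.isCompact_preimage (isCompact_univ_pi (h.isCompact hT hQ hφ))
  convert this
  ext y
  simp [subExtended]

/-- With constant bound `1` nothing is cut off, so the ANR property of the whole telescope is a case
of the result for its subsets. -/
theorem isAdmissible_univ_one : IsAdmissible p univ fun _ _ => 1 :=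
  ⟨fun _ => continuous_const, fun _ _ => trivial, fun _ _ _ => le_rfl⟩

theorem subTelescope_univ_one : ∀ n, subTelescope p univ (fun _ _ => 1) n = univ
  | 0 => rfl
  | n + 1 => eq_univ_of_forall fun z => mem_subTelescope_succ.2
      ⟨by rw [subTelescope_univ_one n]; trivial, fun _ s _ => s.2.2⟩

theorem isANESet_univ_extendedTelescope (hP : ∀ n, IsPolyhedron (P n)) :
    IsANESet (univ : Set (ExtendedTelescope p)) := by
  have := isAdmissible_univ_one.isANESet_subExtended (finiteTelescope_metrizableSpace p hP)
    (hP 0).isANESet_univ fun n => (hP n).isANESet_univ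
  convert this
  refine (eq_univ_of_forall fun y n => ?_).symm
  rw [subTelescope_univ_one]
  trivial

end Telescope

/-! ### Enclosing compact sets -/

/-- A compact subset of a mapping cylinder with locally compact top lies under the graph of
a function that is proper over `(0, ∞)` and is supported near the compact set. -/
theorem MapCyl.exists_continuous_height_le {A B : Type u} [TopologicalSpace A] [TopologicalSpace B]
    [TopologicalSpace.MetrizableSpace A] [LocallyCompactSpace A] (f : C(A, B))
    {C : Set (MapCyl f)} (hC : IsCompact C) {G : Set A} (hG : IsOpen G)
    (hCG : ∀ a s, body a s ∈ C → a ∈ G) :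
    ∃ φ : A → ℝ, Continuous φ ∧ (∀ δ > 0, IsCompact {a | δ ≤ φ a}) ∧ (∀ a, 0 < φ a → a ∈ G) ∧
      (∀ a s, body a s ∈ C → s ≤ φ a) ∧ top f ⁻¹' C ⊆ interior {a | 1 ≤ φ a} := by
  -- `L k` is the compact shadow in `A` of the part of `C` at height at least `(1 / 2) ^ k`. Compact
  -- sets `V k ⊆ G` are then nested, each in the interior of the next, with `L k` in the interior of
  -- `V k`; `φ` is at least `2 * (1 / 2) ^ n` on `V n` and at most that outside.
  let L : ℕ → Set A := fun k => {a | ∃ s : Ioc (0 : ℝ) 1, (1 / 2) ^ k ≤ (s : ℝ) ∧ body a s ∈ C}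
  have hLG : ∀ k, L k ⊆ G := fun k a ⟨s, _, ha⟩ => hCG a s ha
  have hL : ∀ k, IsCompact (L k) := by
    intro k
    rcases isEmpty_or_nonempty A with hA | hA
    · rw [eq_empty_of_isEmpty (L k)]; exact isCompact_empty
    · have hpos : (0 : ℝ) < (1 / 2) ^ k := by positivity
      have : L k = comp f '' (C ∩ {z | (1 / 2) ^ k ≤ height f z}) := by
        ext a
        constructor
        · rintro ⟨s, hs, ha⟩
          exact ⟨body a s, ⟨ha, hs⟩, rfl⟩
        · rintro ⟨z, ⟨hz, hz'⟩, rfl⟩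
          cases z with
          | body a s => exact ⟨s, hz', hz⟩
          | base b => exact absurd hz' (not_le.2 hpos)
      rw [this]
      refine (hC.inter_right (isClosed_le continuous_const (continuous_height f))).image_of_continuousOn
        ((continuousOn_comp f).mono fun z hz => hpos.trans_le hz.2)
  have hstep : ∀ (k : ℕ) (V : {V : Set A // IsCompact V ∧ V ⊆ G}),
      ∃ V' : {V : Set A // IsCompact V ∧ V ⊆ G}, V.1 ∪ L k ⊆ interior V'.1 := fun k V => by
    obtain ⟨V', h1, h2, h3⟩ := exists_compact_between (V.2.1.union (hL k)) hG
      (union_subset V.2.2 (hLG k))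
    exact ⟨⟨V', h1, h3⟩, h2⟩
  choose next hnext using hstep
  let V : ℕ → {V : Set A // IsCompact V ∧ V ⊆ G} := fun k =>
    Nat.rec (next 0 ⟨∅, isCompact_empty, empty_subset _⟩) (fun k V => next (k + 1) V) k
  have hVsucc : ∀ k, (V k).1 ⊆ interior (V (k + 1)).1 := fun k =>
    subset_union_left.trans (hnext (k + 1) (V k))
  have hLV : ∀ k, L k ⊆ interior (V k).1
    | 0 => subset_union_right.trans (hnext 0 _)
    | k + 1 => subset_union_right.trans (hnext (k + 1) (V k))
  have hVmono : ∀ m n, m ≤ n → (V m).1 ⊆ (V n).1 := fun m n hmn =>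
    monotone_nat_of_le_succ (f := fun k => (V k).1)
      (fun k => (hVsucc k).trans interior_subset) hmn
  obtain ⟨φ, hφ, hφ0, hφC, hφD⟩ := exists_continuous_dyadic
    (C := fun n => (interior (V (n + 1)).1)ᶜ) (D := fun n => (V n).1)
    (fun n => isOpen_interior.isClosed_compl) (fun n => (V n).2.1.isClosed)
    (fun n => disjoint_compl_left_iff_subset.2 (hVsucc n))
  have hin : ∀ n a, a ∈ (V n).1 → 2 * (1 / 2) ^ n ≤ φ a := fun n a ha =>
    hφD n a fun m hm => hVmono n m hm ha
  have hout : ∀ n a, a ∉ (V n).1 → φ a ≤ 2 * (1 / 2) ^ n := fun n a ha =>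
    hφC n a fun m hm h => ha (hVmono (m + 1) n hm (interior_subset h))
  have hlarge : ∀ δ > 0, ∃ n, {a | δ ≤ φ a} ⊆ (V n).1 := by
    intro δ hδ
    obtain ⟨n, hn⟩ := exists_pow_lt_of_lt_one (half_pos hδ) (show (1 / 2 : ℝ) < 1 by norm_num)
    refine ⟨n, fun a ha => by_contra fun h => ?_⟩
    have h1 := hout n a h
    have h2 : δ ≤ φ a := ha
    linarith
  refine ⟨φ, hφ, fun δ hδ => ?_, fun a ha => ?_, fun a s ha => ?_, fun a ha => ?_⟩
  · obtain ⟨n, hn⟩ := hlarge δ hδ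
    exact (V n).2.1.of_isClosed_subset (isClosed_le continuous_const hφ) hn
  · obtain ⟨n, hn⟩ := hlarge (φ a) ha
    exact (V n).2.2 (hn (show φ a ≤ φ a from le_rfl))
  · obtain ⟨n, hn1, hn2⟩ := exists_nat_pow_near_of_lt_one s.2.1 s.2.2
      (show (0 : ℝ) < 1 / 2 by norm_num) (by norm_num)
    -- Here `s ≤ (1 / 2) ^ n = 2 * (1 / 2) ^ (n + 1) ≤ φ a`; the factor `2` absorbs the shift of
    -- index.
    have h1 := hin (n + 1) a (interior_subset (hLV (n + 1) ⟨s, hn1.le, ha⟩))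
    rw [pow_succ] at h1
    linarith
  · have h0 : a ∈ interior (V 0).1 := hLV 0 ⟨⟨1, one_pos, le_rfl⟩, by simp, ha⟩
    refine interior_mono (fun b hb => ?_) h0
    have := hin 0 b hb
    rw [mem_ofPred_eq]
    linarith

section Telescope

open MapCyl

variable {P : ℕ → Type u} [∀ i, TopologicalSpace (P i)] {p : ∀ i, C(P (i + 1), P i)}

theorem tendsto_extendedTelescope {ι : Type*} {l : Filter ι} {g : ι → ExtendedTelescope p}
    {y : ExtendedTelescope p} (h : ∀ m, Tendsto (fun i => (g i).1 m) l (𝓝 (y.1 m))) :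
    Tendsto g l (𝓝 y) :=
  tendsto_subtype_rng.2 (tendsto_pi_nhds.2 h)

/-- Truncating at stage `k n` leaves coordinate `m` unchanged once `k n ≥ m`, so coordinatewise
limits are not affected. -/
theorem tendsto_finiteInclusion {k : ℕ → ℕ} (hk : Tendsto k atTop atTop)
    {y : ℕ → ExtendedTelescope p} {z : ExtendedTelescope p} (h : Tendsto y atTop (𝓝 z)) :
    Tendsto (fun n => finiteInclusion p (k n) ((y n).1 (k n))) atTop (𝓝 z) := by
  refine tendsto_extendedTelescope fun m => ?_
  refine (((continuous_coordinate m).tendsto z).comp h).congr' ?_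
  filter_upwards [hk.eventually_ge_atTop m] with n hn
  rw [finiteInclusion_of_le hn, retrLE_coordinate]
  rfl

/-- Each compact subset of the extended telescope lies in a compact set of the form
`subExtended p Q φ` that meets the limit in the same set. -/
theorem exists_isAdmissible_of_isCompact [∀ i, LocallyCompactSpace (P i)]
    (hP : ∀ n, IsPolyhedron (P n)) {K : Set (ExtendedTelescope p)} (hK : IsCompact K) :
    ∃ (Q : Set (P 0)) (φ : ∀ n, P (n + 1) → ℝ), IsAdmissible p Q φ ∧ IsCompact Q ∧ IsANESet Q ∧
      (∀ n, ∀ δ > 0, IsCompact {a | δ ≤ φ n a}) ∧ K ⊆ subExtended p Q φ ∧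
      subExtended p Q φ ∩ range (limitInclusion p) ⊆ K := by
  have hT := finiteTelescope_metrizableSpace p hP
  have := extendedTelescope_metrizableSpace hT
  have := fun n => (hP n).metrizableSpace
  let _ := TopologicalSpace.metrizableSpaceMetric (ExtendedTelescope p)
  let Kn : ∀ n, Set (FiniteTelescope p n) := fun n => (fun y : ExtendedTelescope p => y.1 n) '' K
  have hKn : ∀ n, IsCompact (Kn n) := fun n => hK.image (continuous_coordinate n)
  obtain ⟨Q, hQc, hQ, hKQ⟩ := (hP 0).exists_isCompact_isANESet (hKn 0)
  -- Closeness to `K` is measured between truncations at stage `n`, in one fixed metric of the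
  -- extended telescope, so that the bounds for different `n` can be combined.
  let O : ∀ n, Set (P (n + 1)) := fun n => {a | ∃ y ∈ K,
    dist (finiteInclusion p n (lastLevel p n (p n a))) (finiteInclusion p n (y.1 n)) < 1 / (n + 1)}
  have hO : ∀ n, IsOpen (O n) := by
    intro n
    have : O n = ⋃ y ∈ K, {a | dist (finiteInclusion p n (lastLevel p n (p n a)))
        (finiteInclusion p n (y.1 n)) < 1 / (n + 1)} := by
      ext a; simp [O]
    rw [this]
    refine isOpen_biUnion fun y _ => isOpen_lt ?_ continuous_const
    exact ((continuous_finiteInclusion n).comp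
      ((lastLevel p n).continuous.comp (p n).continuous)).dist continuous_const
  have hbody : ∀ n a s, body (f := attachingMap p n) a s ∈ Kn (n + 1) →
      ∃ y ∈ K, y.1 n = lastLevel p n (p n a) := by
    rintro n a s ⟨y, hy, hya⟩
    refine ⟨y, hy, ?_⟩
    rw [← y.2 n]
    exact congrArg (telescopeRetr p n) hya
  have hstep : ∀ (n : ℕ) (G : {G : Set (P n) // IsOpen G ∧ lastLevel p n ⁻¹' Kn n ⊆ G}),
      ∃ φ : P (n + 1) → ℝ, Continuous φ ∧ (∀ δ > 0, IsCompact {a | δ ≤ φ a}) ∧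
        (∀ a, 0 < φ a → a ∈ p n ⁻¹' G.1 ∩ O n) ∧
        (∀ a s, body (f := attachingMap p n) a s ∈ Kn (n + 1) → s ≤ φ a) ∧
        lastLevel p (n + 1) ⁻¹' Kn (n + 1) ⊆ interior {a | 1 ≤ φ a} := by
    intro n G
    refine exists_continuous_height_le (attachingMap p n) (hKn (n + 1))
      ((G.2.1.preimage (p n).continuous).inter (hO n)) fun a s ha => ?_
    obtain ⟨y, hy, hya⟩ := hbody n a s ha
    refine ⟨G.2.2 ⟨y, hy, hya⟩, y, hy, ?_⟩
    rw [hya, dist_self]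
    positivity
  choose φ hφ hφc hφG hφK hφtop using hstep
  -- The support of each `φ` is confined to the preimage of the interior of the full-height part of
  -- the preceding level; this gives admissibility.
  let G : ∀ n, {G : Set (P n) // IsOpen G ∧ lastLevel p n ⁻¹' Kn n ⊆ G} := fun n =>
    Nat.rec ⟨interior Q, isOpen_interior, hKQ⟩
      (fun n G => ⟨interior {a | 1 ≤ φ n G a}, isOpen_interior, hφtop n G⟩) n
  refine ⟨Q, fun n => φ n (G n), ⟨fun n => hφ n (G n), fun a ha => ?_, fun n a ha => ?_⟩, hQc, hQ,
    fun n => hφc n (G n), fun y hy n => ?_, ?_⟩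
  · exact interior_subset (hφG 0 (G 0) a ha).1
  · have h1 : p (n + 1) a ∈ interior {a | 1 ≤ φ n (G n) a} := (hφG (n + 1) (G (n + 1)) a ha).1
    exact interior_subset (s := {a | 1 ≤ φ n (G n) a}) h1
  · induction n with
    | zero => exact interior_subset (hKQ ⟨y, hy, rfl⟩)
    | succ n ih =>
      refine mem_subTelescope_succ.2 ⟨?_, fun a s h => hφK n (G n) a s ⟨y, hy, h⟩⟩
      rw [y.2 n]
      exact ih
  · rintro _ ⟨hx, x, rfl⟩
    -- A limit point in the subset has height `1` in each cylinder, so `φ n` is positive at its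
    -- coordinates and they lie in `O n`. A subsequence of the nearby points of `K` converges in
    -- `K`, and its limit must be the given point.
    have hclose : ∀ n : ℕ, ∃ y ∈ K, dist (finiteInclusion p n ((limitInclusion p x).1 n))
        (finiteInclusion p n (y.1 n)) < 1 / (n + 1) := by
      intro n
      have h1 : 1 ≤ φ n (G n) (x.1 (n + 1)) := (hx (n + 1)).2 _ _ rfl
      obtain ⟨y, hy, h⟩ := (hφG n (G n) _ (zero_lt_one.trans_le h1)).2
      rw [x.2 n] at h
      exact ⟨y, hy, h⟩
    choose y hyK hy using hclose
    obtain ⟨z, hz, k, hk, hkz⟩ := hK.tendsto_subseq hyK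
    have h1 := tendsto_finiteInclusion hk.tendsto_atTop hkz
    have h2 := tendsto_finiteInclusion hk.tendsto_atTop
      (tendsto_const_nhds (x := limitInclusion p x))
    have h3 : Tendsto (fun n => dist (finiteInclusion p (k n) ((limitInclusion p x).1 (k n)))
        (finiteInclusion p (k n) ((y (k n)).1 (k n)))) atTop (𝓝 0) :=
      squeeze_zero (fun _ => dist_nonneg) (fun n => (hy (k n)).le)
        (tendsto_one_div_add_atTop_nhds_zero_nat.comp hk.tendsto_atTop)
    have h4 : limitInclusion p x = z := dist_eq_zero.1 (tendsto_nhds_unique (h2.dist h1) h3)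
    rwa [h4]

theorem isFineZSet_range_limitInclusion [∀ i, LocallyCompactSpace (P i)]
    (hP : ∀ n, IsPolyhedron (P n)) : IsFineZSet (range (limitInclusion p)) := by
  have hT := finiteTelescope_metrizableSpace p hP
  have := extendedTelescope_metrizableSpace hT
  refine ⟨(isANESet_univ_extendedTelescope hP).isANR, isZSet_range_limitInclusion p,
    fun K hK => ?_⟩
  obtain ⟨Q, φ, h, hQc, hQ, hφ, hKN, hNK⟩ := exists_isAdmissible_of_isCompact hP hK
  exact ⟨subExtended p Q φ, hKN, h.isCompact_subExtended hT hQc hφ,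
    (h.isANESet_subExtended hT hQ fun n => (hP n).isANESet_univ).isANR_coe,
    Subset.antisymm (fun x hx => ⟨hNK hx, hx.2⟩) (inter_subset_inter_left _ hKN),
    isZSet_preimage_range_limitInclusion⟩

end Telescope

end FineShape

theorem mainTheorem8 {P : ℕ → Type u} [∀ i, TopologicalSpace (P i)]
    [∀ i, LocallyCompactSpace (P i)] (hP : ∀ i, FineShape.IsPolyhedron (P i))
    (p : ∀ i, C(P (i + 1), P i))
    {X : Type v} [TopologicalSpace X] (e : X ≃ₜ FineShape.InverseLimit p) :
    FineShape.IsANR (FineShape.ExtendedTelescope p) ∧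
      IsClosedEmbedding (FineShape.limitInclusion p ∘ e) ∧
      FineShape.IsFineZSet (range (FineShape.limitInclusion p ∘ e)) := by
  have hfine := FineShape.isFineZSet_range_limitInclusion (p := p) hP
  refine ⟨hfine.1, (FineShape.isClosedEmbedding_limitInclusion p).comp e.isClosedEmbedding, ?_⟩
  rwa [e.surjective.range_comp]
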